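/- **Setting.** Let $\mathcal C\subset\mathbb R^2$ be a closed, non-self-intersecting curve of length $L>0$, and let $\mathbf v:\mathbb R\to\mathbb R^2$ be its $L$-periodic arc-length parametrization ($|\mathbf v'|=1$, $\mathbf v$ injective on $[0,L)$). For bi-infinite sequences $x$ (of reals or of points of the plane) let $(\Delta x)_i=x_{i+1}-x_i$ and define the B-spline subdivision operators $S_p$ by $$(S_0x)_{2i}=(S_0x)_{2i+1}=x_i,\qquad (S_px)_i=\tfrac12\big((S_{p-1}x)_i+(S_{p-1}x)_{i+1}\big)\quad (p\ge 1,\ i\in\mathbb Z).$$ Let $N\ge1$. The $(S_p,S_{p-2})$ normal multi-scale transform (normal MT) of $\mathcal C$ with initial data $\mathbf v^0_i=\mathbf v(s^0_i)$, where $s^0_0<\dots<s^0_{N-1}<s^0_0+L$ and $s^0_{i+N}=s^0_i+L$, generates data $\mathbf v^j_i=\mathbf v(s^j_i)\in\mathcal C$ and real details $d^j_i$, $j\ge1$, $i\in\mathbb Z$, by $$\mathbf v^j=S_p\mathbf v^{j-1}+d^j\,\hat{\mathbf n}^j,\qquad \hat{\mathbf n}^j_K=\frac{\big((S_{p-2}\Delta\mathbf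 v^{j-1})_K\big)^{\perp}}{\big|(S_{p-2}\Delta\mathbf v^{j-1})_K\big|},$$ where $^\perp$ is the rotation by a right angle; if a normal line meets $\mathcal C$ in several points, any choice of the point is allowed. The transform is *well-posed* if, for all levels, $(S_{p-2}\Delta\mathbf v^{j-1})_K\ne0$ for all $K$, the points $\mathbf v^j_K$ exist, and their arc-length parameters can be (and are) taken with $s^j_i<s^j_{i+1}$ and $s^j_{i+2^jN}=s^j_i+L$ for all $i\in\mathbb Z$. Let $s^j(t)$ and $\mathbf v^j(t)$ be the piecewise linear interpolants of $s^j$ and $\mathbf v^j$ on the grid $2^{-j}\mathbb Z$, so that $s^j(2^{-j}i)=s^j_i$ and $\mathbf v^j(2^{-j}i)=\mathbf v^j_i$. The transform is *convergent* if $s(t)=\lim_{j\to\infty}s^j(t)$ exists for every $t\in\mathbb R$ and is a continuous function of $t$. The *offsets* are $\omega^j=s^j-S_ps^{j-1}$, $j\ge1$. A function on $\mathbb R$ is $C^{3,\alpha}$ if it is three times continuously differentiable and its third derivative is (globally) Hölder continuous with exponent $\alpha$. **Theorem 3.4.** Let $p\ge4$ and let $\mathcal C$ be $C^4$, that is, let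 $\mathbf v$ be four times continuously differentiable on $\mathbb R$. Suppose that the $(S_p,S_{p-2})$ normal MT of $\mathcal C$ with initial data $\mathbf v^0$ is well-posed and convergent. Then there is a constant $C$ such that $$|\omega^j_K|\le C\,2^{-4j}\qquad\text{for all } j\ge1,\ K\in\mathbb Z.$$ Moreover $\lim_{j\to\infty}\mathbf v^j(t)=\mathbf v(s(t))$ for every $t\in\mathbb R$, and the normal re-parametrization is $C^{3,\alpha}$ for every $\alpha\in(0,1)$: both $t\mapsto s(t)$ and $t\mapsto\mathbf v(s(t))$ are $C^{3,\alpha}$. -/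

import Mathlib

/-- The Euclidean plane. -/
abbrev Plane : Type := EuclideanSpace ℝ (Fin 2)

/-- Forward difference of a bi-infinite sequence. -/
def fwdDelta {E : Type*} [AddCommGroup E] (x : ℤ → E) : ℤ → E :=
  fun i => x (i + 1) - x i

/-- The (non-centred) B-spline subdivision operator `S_p` of degree `p`, given by the
Lane-Riesenfeld recursion. Integer division rounds down, so
`(S_0 x)_{2i} = (S_0 x)_{2i+1} = x_i`. -/
noncomputable def bsplineSub {E : Type*} [AddCommGroup E] [Module ℝ E] :
    ℕ → (ℤ → E) → ℤ → E
  | 0, x => fun i => x (i / 2)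
  | p + 1, x => fun i => (1 / 2 : ℝ) • (bsplineSub p x i + bsplineSub p x (i + 1))

/-- Rotation of a plane vector by a right angle. -/
noncomputable def perp (w : Plane) : Plane := !₂[-(w 1), w 0]

/-- `v` is the `L`-periodic, regular `C^1` arc-length parametrization of a closed,
non-self-intersecting plane curve of length `L`. -/
structure IsClosedArcLengthCurve (L : ℝ) (v : ℝ → Plane) : Prop where
  length_pos : 0 < L
  contDiff : ContDiff ℝ 1 v
  periodic : Function.Periodic v L
  unit_speed : ∀ t, ‖deriv v t‖ = 1
  simple : Set.InjOn v (Set.Ico 0 L)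

/-- The approximate unit normals `(S_q Δw)^⊥ / |S_q Δw|` generated from the data `w`. -/
noncomputable def approxNormal (q : ℕ) (w : ℤ → Plane) (K : ℤ) : Plane :=
  ‖bsplineSub q (fwdDelta w) K‖⁻¹ • perp (bsplineSub q (fwdDelta w) K)

/-- A well-posed `(S_p, S_q)` normal multi-scale transform of the closed curve `v` of length
`L`, with `N` initial points. Here `s j` is the sequence of arc-length parameters of the data
`v^j = v ∘ s j` at level `j`, and `d j`, `j ≥ 1`, are the details.

* each `s j` is strictly increasing and runs once around the curve in `2^j N` steps
  (for `j = 0` this is the periodic extension of `s_0 < ... < s_{N-1} < s_0 + L`);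
* the approximate normals are well defined;
* `v^{j+1} = S_p v^j + d^{j+1} n^{j+1}`, where the left-hand side lies on the curve.

No rule is imposed for choosing among several intersection points of a normal line with the
curve. -/
structure IsWellPosedNormalMT (v : ℝ → Plane) (L : ℝ) (N p q : ℕ) (s d : ℕ → ℤ → ℝ) :
    Prop where
  strictMono : ∀ j, StrictMono (s j)
  periodic : ∀ j i, s j (i + 2 ^ j * (N : ℤ)) = s j i + L
  normal_ne_zero : ∀ j K, bsplineSub q (fwdDelta (fun i => v (s j i))) K ≠ 0
  step : ∀ j K, v (s (j + 1) K) =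
    bsplineSub p (fun i => v (s j i)) K
      + d (j + 1) K • approxNormal q (fun i => v (s j i)) K

/-- The piecewise linear interpolant of the data `x` on the grid `2^{-j} ℤ`, that is, the
function with value `x i` at `2^{-j} i` which is affine between neighbouring grid points. -/
noncomputable def gridInterp {E : Type*} [AddCommGroup E] [Module ℝ E]
    (j : ℕ) (x : ℤ → E) (t : ℝ) : E :=
  (1 - Int.fract (2 ^ j * t)) • x ⌊2 ^ j * t⌋ + Int.fract (2 ^ j * t) • x (⌊2 ^ j * t⌋ + 1)

/-- Convergence of the transform: the interpolants `s^j(t)` of the arc-length data converge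
to the continuous function `σ`. -/
structure ConvergesTo (s : ℕ → ℤ → ℝ) (σ : ℝ → ℝ) : Prop where
  continuous : Continuous σ
  tendsto : ∀ t, Filter.Tendsto (fun j => gridInterp j (s j) t) Filter.atTop (nhds (σ t))

/-- The offsets `ω^j = s^j - S_p s^{j-1}`, `j ≥ 1`. -/
noncomputable def offset (p : ℕ) (s : ℕ → ℤ → ℝ) (j : ℕ) (K : ℤ) : ℝ :=
  s j K - bsplineSub p (s (j - 1)) K

/-- The class `C^{k,α}`: `k` times continuously differentiable with a `k`-th derivative that
is (globally) Hölder continuous of exponent `α`. -/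
def IsHolderSmooth {E : Type*} [NormedAddCommGroup E] [NormedSpace ℝ E]
    (k : ℕ) (α : NNReal) (f : ℝ → E) : Prop :=
  ContDiff ℝ k f ∧ ∃ C : NNReal, HolderWith C α (iteratedDeriv k f)

/-!
The detail equation says that the vector from `(S_p v^{j-1})_K` to `v^j_K` is orthogonal to the
discrete tangent `(S_{p-2} Δv^{j-1})_K`. Taylor expansion of `v` at the parameter
`y = (S_p s^{j-1})_K` turns this into an equation for the offset `ω = s^j_K - y`. With
`c = (S_{p-2} Δs^{j-1})_K` and `z = s^{j-1} - y` it gives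
`|ω| ≤ C (c⁴ + c |(S_{p-2} Δz²)_K| + |(S_p z³)_K|)`
(`BoundedDerivs.exists_abs_offset_le`): the tangent is orthogonal to `v''`, so, up to the
first term on the right, the second moment of `z` only enters through the component along `v''` of
the discrete tangent. The size of all `z_i` in
the support is at most a multiple of `c`, because the parameters increase and `S_{p-2}` puts a
positive weight on each increment; no lower bound on the mesh is needed.

Hence `ω = O(h³)`, where `h` is the mesh size. Moreover `(S_{p-2} Δz²)_K` and `(S_p z³)_K` vanish
for linear sequences: the two operators have the same centre and the third central moment of `S_p`
is zero for `p ≥ 3`. So `ω = O(h⁴ + h² sup |Δ²s|)` (`BoundedDerivs.exists_abs_offset_le_mesh`).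

Convergence to a continuous limit is automatically uniform, since the data are monotone and periodic
(`ConvergesTo.exists_mesh_le`); so `h → 0` and `ω → 0`, which makes the local estimates applicable.
As `Δ^k S_p = 2^{-k} S_{p-k} Δ^k` and `S_{p-k}` averages, the bound `ω = O(h³)` yields
`h = O(2^{-j})`, next `Δ²s^j = O(4^{-j})`, therefore `ω^j = O(16^{-j})`, and finally
`Δ^k s^j = O(j 2^{-kj})` for `k ≤ 4` (`IsWellPosedNormalMT.exists_rates`).

The scaled differences `2^{kj} Δ^k s^j`, `k ≤ 3`, then change by `O(j 2^{-j})` per step and have mesh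
differences of that order; they converge to functions with a modulus of continuity of the type
`δ log (1 / δ)` (`exists_limit_of_refinement`), each the derivative of the previous one
(`hasDerivAt_of_tendsto_grid`). This is the smoothness of the limit `σ`, and that of
`v ∘ σ` follows by the chain rule.
-/

open Filter Topology

/-! ### Subdivision operators: algebra, averaging and moments -/

theorem iterate_fwdDelta_add {E : Type*} [AddCommGroup E] (k : ℕ) (x y : ℤ → E) :
    fwdDelta^[k] (x + y) = fwdDelta^[k] x + fwdDelta^[k] y := by
  induction k generalizing x y with
  | zero => rfl
  | succ k ih =>
    have h : fwdDelta (x + y) = fwdDelta x + fwdDelta y := by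
      funext i; simp only [fwdDelta, Pi.add_apply]; abel
    rw [Function.iterate_succ_apply, h, ih, Function.iterate_succ_apply,
      Function.iterate_succ_apply]

section Bspline

variable {E F : Type*} [AddCommGroup E] [Module ℝ E] [AddCommGroup F] [Module ℝ F]

theorem bsplineSub_zero (x : ℤ → E) (K : ℤ) : bsplineSub 0 x K = x (K / 2) := rfl

theorem bsplineSub_succ (p : ℕ) (x : ℤ → E) (K : ℤ) :
    bsplineSub (p + 1) x K = (1 / 2 : ℝ) • (bsplineSub p x K + bsplineSub p x (K + 1)) := rfl

theorem bsplineSub_map (φ : E →ₗ[ℝ] F) (p : ℕ) (x : ℤ → E) (K : ℤ) :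
    bsplineSub p (fun i => φ (x i)) K = φ (bsplineSub p x K) := by
  induction p generalizing K with
  | zero => rfl
  | succ p ih => simp only [bsplineSub_succ, ih, map_smul, map_add]

theorem bsplineSub_add (p : ℕ) (x y : ℤ → E) (K : ℤ) :
    bsplineSub p (fun i => x i + y i) K = bsplineSub p x K + bsplineSub p y K := by
  induction p generalizing K with
  | zero => rfl
  | succ p ih => simp only [bsplineSub_succ, ih]; module

theorem bsplineSub_sub (p : ℕ) (x y : ℤ → E) (K : ℤ) :
    bsplineSub p (fun i => x i - y i) K = bsplineSub p x K - bsplineSub p y K := by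
  induction p generalizing K with
  | zero => rfl
  | succ p ih => simp only [bsplineSub_succ, ih]; module

theorem bsplineSub_const (p : ℕ) (a : E) (K : ℤ) :
    bsplineSub p (fun _ => a) K = a := by
  induction p generalizing K with
  | zero => rfl
  | succ p ih => simp only [bsplineSub_succ, ih]; module

theorem bsplineSub_const_smul (p : ℕ) (r : ℝ) (x : ℤ → E) (K : ℤ) :
    bsplineSub p (fun i => r • x i) K = r • bsplineSub p x K :=
  bsplineSub_map (r • LinearMap.id) p x K

theorem bsplineSub_const_mul (p : ℕ) (r : ℝ) (x : ℤ → ℝ) (K : ℤ) :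
    bsplineSub p (fun i => r * x i) K = r * bsplineSub p x K :=
  bsplineSub_const_smul p r x K

theorem bsplineSub_smul_const (p : ℕ) (z : ℤ → ℝ) (a : E) (K : ℤ) :
    bsplineSub p (fun i => z i • a) K = bsplineSub p z K • a :=
  bsplineSub_map (LinearMap.toSpanSingleton ℝ E a) p z K

theorem bsplineSub_add_two (p : ℕ) (x : ℤ → E) (K : ℤ) :
    bsplineSub p x (K + 2) = bsplineSub p (fun i => x (i + 1)) K := by
  induction p generalizing K with
  | zero => simp only [bsplineSub_zero]; congr 1; omega
  | succ p ih =>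
    simp only [bsplineSub_succ, ← ih]
    rw [show K + 1 + 2 = K + 2 + 1 by ring]

/-- Differences commute with subdivision at the cost of one degree and a factor `1 / 2`. -/
theorem fwdDelta_bsplineSub_succ (p : ℕ) (x : ℤ → E) (K : ℤ) :
    fwdDelta (bsplineSub (p + 1) x) K = (1 / 2 : ℝ) • bsplineSub p (fwdDelta x) K := by
  have h : bsplineSub p (fwdDelta x) K = bsplineSub p x (K + 2) - bsplineSub p x K := by
    rw [bsplineSub_add_two, ← bsplineSub_sub]; rfl
  rw [h, fwdDelta, bsplineSub_succ, bsplineSub_succ, show K + 1 + 1 = K + 2 by ring]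
  module

theorem fwdDelta_const_smul (r : ℝ) (x : ℤ → E) :
    fwdDelta (r • x) = r • fwdDelta x := by
  funext i; simp [fwdDelta, smul_sub]

theorem iterate_fwdDelta_const_smul (k : ℕ) (r : ℝ) (x : ℤ → E) :
    fwdDelta^[k] (r • x) = r • fwdDelta^[k] x := by
  induction k generalizing x with
  | zero => rfl
  | succ k ih => rw [Function.iterate_succ_apply, fwdDelta_const_smul, ih,
      Function.iterate_succ_apply]

theorem iterate_fwdDelta_bsplineSub (k q : ℕ) (x : ℤ → E) :
    fwdDelta^[k] (bsplineSub (q + k) x) = (1 / 2 : ℝ) ^ k • bsplineSub q (fwdDelta^[k] x) := by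
  induction k generalizing x with
  | zero => simp
  | succ k ih =>
    have h : fwdDelta (bsplineSub (q + k + 1) x)
        = (1 / 2 : ℝ) • bsplineSub (q + k) (fwdDelta x) :=
      funext fun K => fwdDelta_bsplineSub_succ _ _ _
    rw [Function.iterate_succ_apply, ← add_assoc, h, iterate_fwdDelta_const_smul, ih,
      Function.iterate_succ_apply, smul_smul, pow_succ']

/-- Subdivision is local averaging: `(S_p x)_K` is a convex combination of the `x_i` with
`K / 2 ≤ i ≤ (K + p) / 2`. -/
theorem bsplineSub_mem_of_convex {s : Set E} (hs : Convex ℝ s) (p : ℕ) (x : ℤ → E) (K : ℤ)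
    (hx : ∀ i, K / 2 ≤ i → i ≤ (K + p) / 2 → x i ∈ s) : bsplineSub p x K ∈ s := by
  induction p generalizing K with
  | zero => exact hx _ le_rfl (by simp)
  | succ p ih =>
    have h1 := ih K fun i h h' => hx i h (by push_cast; omega)
    have h2 := ih (K + 1) fun i h h' => hx i (by omega) (by push_cast; omega)
    rw [bsplineSub_succ, smul_add]
    exact hs h1 h2 (by norm_num) (by norm_num) (by norm_num)

end Bspline

theorem norm_bsplineSub_le {E : Type*} [SeminormedAddCommGroup E] [NormedSpace ℝ E] (p : ℕ)
    (x : ℤ → E) (K : ℤ) {B : ℝ} (hx : ∀ i, K / 2 ≤ i → i ≤ (K + p) / 2 → ‖x i‖ ≤ B) :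
    ‖bsplineSub p x K‖ ≤ B := by
  have := bsplineSub_mem_of_convex (convex_closedBall (0 : E) B) p x K
    (by simpa using hx)
  simpa using this

theorem abs_bsplineSub_le (p : ℕ) (x : ℤ → ℝ) (K : ℤ) {B : ℝ}
    (hx : ∀ i, K / 2 ≤ i → i ≤ (K + p) / 2 → |x i| ≤ B) : |bsplineSub p x K| ≤ B :=
  norm_bsplineSub_le p x K hx

theorem bsplineSub_nonneg (p : ℕ) (x : ℤ → ℝ) (K : ℤ) (hx : ∀ i, 0 ≤ x i) :
    0 ≤ bsplineSub p x K :=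
  bsplineSub_mem_of_convex (convex_Ici 0) p x K fun i _ _ => hx i

/-- Every entry in the support enters `S_p` with weight at least `2 ^ (-p)`. -/
theorem le_two_pow_mul_bsplineSub (p : ℕ) (x : ℤ → ℝ) (hx : ∀ i, 0 ≤ x i) (K i : ℤ)
    (h : K / 2 ≤ i) (h' : i ≤ (K + p) / 2) : x i ≤ 2 ^ p * bsplineSub p x K := by
  induction p generalizing K with
  | zero =>
    have : i = K / 2 := le_antisymm (by simpa using h') h
    simp [bsplineSub_zero, this]
  | succ p ih =>
    have h0 := bsplineSub_nonneg p x K hx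
    have h1 := bsplineSub_nonneg p x (K + 1) hx
    have h2 : (0 : ℝ) < 2 ^ p := by positivity
    rw [bsplineSub_succ, smul_eq_mul, pow_succ]
    push_cast at h'
    by_cases hi : i ≤ (K + p) / 2
    · nlinarith [ih K h hi, mul_nonneg h2.le h1]
    · nlinarith [ih (K + 1) (by omega) (by omega), mul_nonneg h2.le h0]

/-- Each averaging moves the data by at most half the mesh size, so `S_p` stays close to `S_0`. -/
theorem norm_bsplineSub_sub_le {E : Type*} [SeminormedAddCommGroup E] [NormedSpace ℝ E] (p : ℕ)
    (x : ℤ → E) {D : ℝ} (hD : ∀ i, ‖fwdDelta x i‖ ≤ D) (K : ℤ) :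
    ‖bsplineSub p x K - x (K / 2)‖ ≤ p * D := by
  have key : ‖bsplineSub p x K - x (K / 2)‖ ≤ p * D ∧
      ∀ K, ‖fwdDelta (bsplineSub p x) K‖ ≤ D := by
    have hD0 : 0 ≤ D := (norm_nonneg _).trans (hD 0)
    induction p with
    | zero =>
      refine ⟨by simp [bsplineSub_zero], fun K => ?_⟩
      simp only [fwdDelta, bsplineSub_zero]
      rcases Int.even_or_odd' K with ⟨m, rfl | rfl⟩
      · rw [show (2 * m + 1) / 2 = m by omega, show 2 * m / 2 = m by omega]
        simpa using hD0
      · rw [show (2 * m + 1 + 1) / 2 = m + 1 by omega, show (2 * m + 1) / 2 = m by omega]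
        exact hD m
    | succ p ih =>
      refine ⟨?_, fun K => ?_⟩
      · have h : bsplineSub (p + 1) x K - x (K / 2)
            = (bsplineSub p x K - x (K / 2)) + (1 / 2 : ℝ) • fwdDelta (bsplineSub p x) K := by
          rw [bsplineSub_succ, fwdDelta]; module
        have h2 : ‖(1 / 2 : ℝ) • fwdDelta (bsplineSub p x) K‖ ≤ D := by
          rw [norm_smul, Real.norm_of_nonneg (by norm_num)]
          linarith [ih.2 K]
        rw [h]; push_cast
        linarith [norm_add_le (bsplineSub p x K - x (K / 2))
          ((1 / 2 : ℝ) • fwdDelta (bsplineSub p x) K), ih.1]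
      · rw [fwdDelta_bsplineSub_succ, norm_smul, Real.norm_of_nonneg (by norm_num)]
        linarith [norm_bsplineSub_le p (fwdDelta x) K fun i _ _ => hD i]
  exact key.1

/-- First moment: `S_p` maps the identity sequence to the centres `K / 2 + (p - 1) / 4`. -/
theorem bsplineSub_intCast (p : ℕ) (hp : 1 ≤ p) (K : ℤ) :
    bsplineSub p (fun i => (i : ℝ)) K = K / 2 + (p - 1) / 4 := by
  induction p, hp using Nat.le_induction generalizing K with
  | base =>
    rw [bsplineSub_succ, bsplineSub_zero, bsplineSub_zero]
    rcases Int.even_or_odd' K with ⟨m, rfl | rfl⟩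
    · rw [show (2 * m + 1) / 2 = m by omega, show 2 * m / 2 = m by omega]
      push_cast; rw [smul_eq_mul]; ring
    · rw [show (2 * m + 1 + 1) / 2 = m + 1 by omega, show (2 * m + 1) / 2 = m by omega]
      push_cast; rw [smul_eq_mul]; ring
  | succ p _ ih =>
    rw [bsplineSub_succ, ih, ih]; push_cast; rw [smul_eq_mul]; ring

/-- Third moments. For `p ≥ 3` the mask at every index has the first three moments of a
distribution with mean `K / 2 + (p - 1) / 4`, variance `(p + 1) / 16` and no skewness. -/
theorem bsplineSub_sub_pow_three (p : ℕ) (hp : 3 ≤ p) (a : ℝ) (K : ℤ) :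
    bsplineSub p (fun i => ((i : ℝ) - a) ^ 3) K =
      (K / 2 + (p - 1) / 4 - a) ^ 3 + 3 * (K / 2 + (p - 1) / 4 - a) * ((p + 1) / 16) := by
  induction p, hp using Nat.le_induction generalizing K with
  | base =>
    simp only [bsplineSub_succ, bsplineSub_zero, smul_eq_mul]
    rcases Int.even_or_odd' K with ⟨m, rfl | rfl⟩
    · rw [show (2 * m + 1 + 1 + 1) / 2 = m + 1 by omega, show (2 * m + 1 + 1) / 2 = m + 1 by omega,
        show (2 * m + 1) / 2 = m by omega, show 2 * m / 2 = m by omega]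
      push_cast; ring
    · rw [show (2 * m + 1 + 1 + 1 + 1) / 2 = m + 2 by omega,
        show (2 * m + 1 + 1 + 1) / 2 = m + 1 by omega,
        show (2 * m + 1 + 1) / 2 = m + 1 by omega, show (2 * m + 1) / 2 = m by omega]
      push_cast; ring
  | succ p _ ih =>
    rw [bsplineSub_succ, ih, ih]; push_cast; rw [smul_eq_mul]; ring

/-! ### Taylor expansion of the curve -/

/-- Integrating a derivative bound of order `n` at `y` gives a bound of order `n + 1`. -/
theorem norm_le_mul_abs_pow_succ {E : Type*} [NormedAddCommGroup E] [NormedSpace ℝ E]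
    {f f' : ℝ → E} {y C : ℝ} {n : ℕ} (hC : 0 ≤ C) (hf : ∀ t, HasDerivAt f (f' t) t)
    (h0 : f y = 0) (hb : ∀ t, ‖f' t‖ ≤ C * |t - y| ^ n) (u : ℝ) :
    ‖f u‖ ≤ C * |u - y| ^ (n + 1) := by
  have h := (convex_uIcc y u).norm_image_sub_le_of_norm_hasDerivWithin_le (f := f) (f' := f')
    (C := C * |u - y| ^ n) (fun t _ => (hf t).hasDerivWithinAt) (fun t ht => (hb t).trans ?_)
    Set.left_mem_uIcc Set.right_mem_uIcc
  · rw [h0, sub_zero, Real.norm_eq_abs] at h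
    rw [pow_succ, ← mul_assoc]; exact h
  · have := Set.abs_sub_left_of_mem_uIcc ht
    gcongr

/-- `v₁, v₂, v₃` are the first three derivatives of the unit speed curve `v`; they are bounded,
and `v₃` is Lipschitz. The constant `B ≥ 1` serves for all bounds. -/
structure BoundedDerivs {E : Type*} [NormedAddCommGroup E] [NormedSpace ℝ E]
    (v v₁ v₂ v₃ : ℝ → E) (B : ℝ) : Prop where
  one_le : 1 ≤ B
  hasDerivAt₀ : ∀ t, HasDerivAt v (v₁ t) t
  hasDerivAt₁ : ∀ t, HasDerivAt v₁ (v₂ t) t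
  hasDerivAt₂ : ∀ t, HasDerivAt v₂ (v₃ t) t
  norm_one : ∀ t, ‖v₁ t‖ = 1
  norm_two : ∀ t, ‖v₂ t‖ ≤ B
  norm_three : ∀ t, ‖v₃ t‖ ≤ B
  lipschitz : ∀ t u, ‖v₃ u - v₃ t‖ ≤ B * |u - t|

theorem hasDerivAt_sub_smul {E : Type*} [NormedAddCommGroup E] [NormedSpace ℝ E] (y : ℝ) (a : E)
    (t : ℝ) : HasDerivAt (fun t => (t - y) • a) a t := by
  simpa using ((hasDerivAt_id t).sub_const y).smul_const a

theorem hasDerivAt_sub_pow_two_smul {E : Type*} [NormedAddCommGroup E] [NormedSpace ℝ E] (y : ℝ)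
    (a : E) (t : ℝ) : HasDerivAt (fun t => (t - y) ^ 2 • (1 / 2 : ℝ) • a) ((t - y) • a) t := by
  have h := (((hasDerivAt_id' t).sub_const y).fun_pow 2).smul_const ((1 / 2 : ℝ) • a)
  convert h using 1
  push_cast; module

theorem hasDerivAt_sub_pow_three_smul {E : Type*} [NormedAddCommGroup E] [NormedSpace ℝ E] (y : ℝ)
    (a : E) (t : ℝ) :
    HasDerivAt (fun t => (t - y) ^ 3 • (1 / 6 : ℝ) • a) ((t - y) ^ 2 • (1 / 2 : ℝ) • a) t := by
  have h := (((hasDerivAt_id' t).sub_const y).fun_pow 3).smul_const ((1 / 6 : ℝ) • a)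
  convert h using 1
  push_cast; module

section Taylor

variable {E : Type*} [NormedAddCommGroup E] [NormedSpace ℝ E] {v v₁ v₂ v₃ : ℝ → E} {B : ℝ}

theorem BoundedDerivs.nonneg (h : BoundedDerivs v v₁ v₂ v₃ B) : 0 ≤ B :=
  zero_le_one.trans h.one_le

theorem BoundedDerivs.taylor_one (h : BoundedDerivs v v₁ v₂ v₃ B) (y u : ℝ) :
    ‖v u - v y - (u - y) • v₁ y‖ ≤ B * |u - y| ^ 2 := by
  have e1 : ∀ t, ‖v₁ t - v₁ y‖ ≤ B * |t - y| ^ 1 :=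
    norm_le_mul_abs_pow_succ (n := 0) h.nonneg (fun t => (h.hasDerivAt₁ t).sub_const _)
      (by simp) (by simpa using h.norm_two)
  exact norm_le_mul_abs_pow_succ (f := fun u => v u - v y - (u - y) • v₁ y) h.nonneg
    (fun t => ((h.hasDerivAt₀ t).sub_const (v y)).fun_sub (hasDerivAt_sub_smul y _ t)) (by simp) e1 u

theorem BoundedDerivs.taylor_two (h : BoundedDerivs v v₁ v₂ v₃ B) (y u : ℝ) :
    ‖v u - v y - (u - y) • v₁ y - (u - y) ^ 2 • (1 / 2 : ℝ) • v₂ y‖ ≤ B * |u - y| ^ 3 := by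
  have e2 : ∀ t, ‖v₂ t - v₂ y‖ ≤ B * |t - y| ^ 1 :=
    norm_le_mul_abs_pow_succ (n := 0) h.nonneg (fun t => (h.hasDerivAt₂ t).sub_const _)
      (by simp) (by simpa using h.norm_three)
  have e1 : ∀ t, ‖v₁ t - v₁ y - (t - y) • v₂ y‖ ≤ B * |t - y| ^ 2 :=
    norm_le_mul_abs_pow_succ (f := fun t => v₁ t - v₁ y - (t - y) • v₂ y) h.nonneg
      (fun t => ((h.hasDerivAt₁ t).sub_const (v₁ y)).fun_sub (hasDerivAt_sub_smul y _ t))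
      (by simp) e2
  exact norm_le_mul_abs_pow_succ
    (f := fun u => v u - v y - (u - y) • v₁ y - (u - y) ^ 2 • (1 / 2 : ℝ) • v₂ y) h.nonneg
    (fun t => (((h.hasDerivAt₀ t).sub_const (v y)).fun_sub (hasDerivAt_sub_smul y _ t)).fun_sub
      (hasDerivAt_sub_pow_two_smul y _ t)) (by simp) e1 u

theorem BoundedDerivs.taylor_three (h : BoundedDerivs v v₁ v₂ v₃ B) (y u : ℝ) :
    ‖v u - v y - (u - y) • v₁ y - (u - y) ^ 2 • (1 / 2 : ℝ) • v₂ y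
      - (u - y) ^ 3 • (1 / 6 : ℝ) • v₃ y‖ ≤ B * |u - y| ^ 4 := by
  have e3 : ∀ t, ‖v₃ t - v₃ y‖ ≤ B * |t - y| ^ 1 := fun t => by simpa using h.lipschitz y t
  have e2 : ∀ t, ‖v₂ t - v₂ y - (t - y) • v₃ y‖ ≤ B * |t - y| ^ 2 :=
    norm_le_mul_abs_pow_succ (f := fun t => v₂ t - v₂ y - (t - y) • v₃ y) h.nonneg
      (fun t => ((h.hasDerivAt₂ t).sub_const (v₂ y)).fun_sub (hasDerivAt_sub_smul y _ t))
      (by simp) e3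
  have e1 : ∀ t, ‖v₁ t - v₁ y - (t - y) • v₂ y - (t - y) ^ 2 • (1 / 2 : ℝ) • v₃ y‖
      ≤ B * |t - y| ^ 3 :=
    norm_le_mul_abs_pow_succ
      (f := fun u => v₁ u - v₁ y - (u - y) • v₂ y - (u - y) ^ 2 • (1 / 2 : ℝ) • v₃ y) h.nonneg
      (fun t => (((h.hasDerivAt₁ t).sub_const (v₁ y)).fun_sub (hasDerivAt_sub_smul y _ t)).fun_sub
        (hasDerivAt_sub_pow_two_smul y _ t)) (by simp) e2
  exact norm_le_mul_abs_pow_succ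
    (f := fun u => v u - v y - (u - y) • v₁ y - (u - y) ^ 2 • (1 / 2 : ℝ) • v₂ y
      - (u - y) ^ 3 • (1 / 6 : ℝ) • v₃ y) h.nonneg
    (fun t => ((((h.hasDerivAt₀ t).sub_const (v y)).fun_sub (hasDerivAt_sub_smul y _ t)).fun_sub
      (hasDerivAt_sub_pow_two_smul y _ t)).fun_sub (hasDerivAt_sub_pow_three_smul y _ t))
    (by simp) e1 u

end Taylor

theorem BoundedDerivs.inner_eq_zero {E : Type*} [NormedAddCommGroup E] [InnerProductSpace ℝ E]
    {v v₁ v₂ v₃ : ℝ → E} {B : ℝ} (h : BoundedDerivs v v₁ v₂ v₃ B) (t : ℝ) :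
    inner ℝ (v₁ t) (v₂ t) = 0 := by
  have h1 := (h.hasDerivAt₁ t).inner ℝ (h.hasDerivAt₁ t)
  have h2 : (fun t => inner ℝ (v₁ t) (v₁ t)) = fun _ => (1 : ℝ) := by
    funext t; rw [real_inner_self_eq_norm_sq, h.norm_one]; norm_num
  rw [h2] at h1
  have h3 := h1.unique (hasDerivAt_const t (1 : ℝ))
  rw [real_inner_comm (v₁ t) (v₂ t)] at h3
  linarith

/-! ### Local estimate of the offset -/

theorem abs_le_of_six {a₁ a₂ a₃ a₄ a₅ a₆ b₁ b₂ b₃ b₄ b₅ b₆ : ℝ} (h₁ : |a₁| ≤ b₁)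
    (h₂ : |a₂| ≤ b₂) (h₃ : |a₃| ≤ b₃) (h₄ : |a₄| ≤ b₄) (h₅ : |a₅| ≤ b₅) (h₆ : |a₆| ≤ b₆) :
    |-a₁ - a₂ + a₃ + a₄ + a₅ + a₆| ≤ b₁ + b₂ + b₃ + b₄ + b₅ + b₆ := by
  rw [abs_le] at *
  constructor <;> linarith

/-- Solving the orthogonality relation for the offset. Here `T` is the unit tangent,
`a₂, a₃` are the higher derivatives, `w` is the offset, and the second vector is the discrete
tangent direction, of length about `c`. Since `a₂ ⟂ T`, the moment `m₂` enters only in the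
products `m₂ e` and `m₂ R'`. -/
theorem abs_le_of_inner_eq_zero {E : Type*} [NormedAddCommGroup E] [InnerProductSpace ℝ E]
    {T a₂ a₃ r R R' : E} {w m₂ m₃ e c Q : ℝ} (hQ : 1 ≤ Q)
    (hT : ‖T‖ = 1) (hTa : inner ℝ T a₂ = 0) (h2 : ‖a₂‖ ≤ Q) (h3 : ‖a₃‖ ≤ Q)
    (hc : 0 < c) (hcQ : 8 * Q ^ 3 * c ≤ 1) (hw : 8 * Q ^ 3 * |w| ≤ 1)
    (hr : ‖r‖ ≤ Q * |w| ^ 2) (hm2 : |m₂| ≤ Q * c ^ 2)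
    (hR : ‖R‖ ≤ Q * c ^ 4) (hR' : ‖R'‖ ≤ Q * c ^ 3) (he : |e| ≤ Q * c ^ 2)
    (hin : inner ℝ (w • T + r - m₂ • a₂ - m₃ • a₃ - R) (c • T + e • a₂ + R') = (0 : ℝ)) :
    |w| ≤ 8 * Q ^ 3 * (c ^ 4 + c * |e| + |m₃|) := by
  set W := c • T + e • a₂ + R' with hW
  have hQ0 : 0 < Q := by linarith
  have hQ3 : 1 ≤ Q ^ 3 := one_le_pow₀ hQ
  have hQ2 : 1 ≤ Q ^ 2 := one_le_pow₀ hQ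
  have hQ13 : Q ≤ Q ^ 3 := by nlinarith
  have hc1 : c ≤ 1 := by nlinarith
  have hQc : Q * c ≤ 1 := by nlinarith
  have hWn : ‖W‖ ≤ 3 * Q ^ 2 * c := by
    have e1 : ‖c • T‖ = c := by rw [norm_smul, hT, Real.norm_of_nonneg hc.le, mul_one]
    have e2 : ‖e • a₂‖ ≤ (Q * c ^ 2) * Q := by
      rw [norm_smul, Real.norm_eq_abs]; gcongr
    have := norm_add₃_le (a := c • T) (b := e • a₂) (c := R')
    have e3 : Q * c ^ 2 * Q ≤ Q ^ 2 * c := by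
      have : Q ^ 2 * c * c ≤ Q ^ 2 * c * 1 := by gcongr
      linarith
    have e4 : Q * c ^ 3 ≤ Q ^ 2 * c := by
      have h1 : Q * c * c * c ≤ 1 * 1 * c := by gcongr
      have h2 : 1 * c ≤ Q ^ 2 * c := by gcongr
      linarith
    have e5 : c ≤ Q ^ 2 * c := by nlinarith
    linarith
  have hexp : w * c = - (w * inner ℝ T R') - inner ℝ r W + m₂ * e * ‖a₂‖ ^ 2
      + m₂ * inner ℝ a₂ R' + m₃ * inner ℝ a₃ W + inner ℝ R W := by
    have t1 : inner ℝ T W = c + inner ℝ T R' := by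
      rw [hW, inner_add_right, inner_add_right, inner_smul_right, inner_smul_right, hTa,
        real_inner_self_eq_norm_sq, hT]; ring
    have t2 : inner ℝ a₂ W = e * ‖a₂‖ ^ 2 + inner ℝ a₂ R' := by
      rw [hW, inner_add_right, inner_add_right, inner_smul_right, inner_smul_right,
        real_inner_comm, hTa, real_inner_self_eq_norm_sq]; ring
    rw [inner_sub_left, inner_sub_left, inner_sub_left, inner_add_left, real_inner_smul_left,
      real_inner_smul_left, real_inner_smul_left, t1, t2] at hin
    linear_combination hin
  have b1 : |w * inner ℝ T R'| ≤ |w| * (Q * c ^ 3) := by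
    rw [abs_mul]
    have := abs_real_inner_le_norm T R'
    rw [hT, one_mul] at this
    gcongr; linarith
  have b2 : |inner ℝ r W| ≤ Q * |w| ^ 2 * (3 * Q ^ 2 * c) :=
    (abs_real_inner_le_norm r W).trans (by gcongr)
  have b3 : |m₂ * e * ‖a₂‖ ^ 2| ≤ Q * c ^ 2 * |e| * Q ^ 2 := by
    rw [abs_mul, abs_mul, abs_of_nonneg (sq_nonneg ‖a₂‖)]
    gcongr
  have b4 : |m₂ * inner ℝ a₂ R'| ≤ Q * c ^ 2 * (Q * (Q * c ^ 3)) := by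
    rw [abs_mul]
    have := abs_real_inner_le_norm a₂ R'
    gcongr
    exact this.trans (by gcongr)
  have b5 : |m₃ * inner ℝ a₃ W| ≤ |m₃| * (Q * (3 * Q ^ 2 * c)) := by
    rw [abs_mul]
    have := abs_real_inner_le_norm a₃ W
    gcongr
    exact this.trans (by gcongr)
  have b6 : |inner ℝ R W| ≤ Q * c ^ 4 * (3 * Q ^ 2 * c) :=
    (abs_real_inner_le_norm R W).trans (by gcongr)
  have hwc : |w| * c = |w * c| := by rw [abs_mul, abs_of_pos hc]
  have htot : |w| * c ≤ |w| * (Q * c ^ 3) + Q * |w| ^ 2 * (3 * Q ^ 2 * c)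
      + Q * c ^ 2 * |e| * Q ^ 2 + Q * c ^ 2 * (Q * (Q * c ^ 3)) + |m₃| * (Q * (3 * Q ^ 2 * c))
      + Q * c ^ 4 * (3 * Q ^ 2 * c) := by
    rw [hwc, hexp]
    exact abs_le_of_six b1 b2 b3 b4 b5 b6
  have f1 : |w| * (Q * c ^ 3) ≤ |w| * c / 8 := by
    have : Q * c ^ 3 ≤ c / 8 := by
      have h8 : 8 * Q * c ≤ 8 * Q ^ 3 * c := by gcongr
      have : (8 * Q * c) * c * c ≤ 1 * 1 * c := by gcongr; linarith
      linarith
    have := mul_le_mul_of_nonneg_left this (abs_nonneg w)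
    linarith
  have f2 : Q * |w| ^ 2 * (3 * Q ^ 2 * c) ≤ 3 * (|w| * c) / 8 := by
    have : (8 * Q ^ 3 * |w|) * (|w| * c) ≤ 1 * (|w| * c) := by gcongr
    linarith
  have htot2 : |w| * c ≤ (8 * Q ^ 3 * (c ^ 4 + c * |e| + |m₃|)) * c := by
    have g1 : 0 ≤ Q ^ 3 * (c ^ 5) := by positivity
    have g2 : 0 ≤ Q ^ 3 * (c ^ 2 * |e|) := by positivity
    have g3 : 0 ≤ Q ^ 3 * (c * |m₃|) := by positivity
    linarith
  exact le_of_mul_le_mul_right htot2 hc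

theorem sub_le_mul_of_fwdDelta_le {x : ℤ → ℝ} {a : ℝ} (m : ℤ) (n : ℕ)
    (h : ∀ i, m ≤ i → i < m + n → fwdDelta x i ≤ a) : x (m + n) - x m ≤ n * a := by
  induction n with
  | zero => simp
  | succ n ih =>
    have h1 := ih fun i hi hi' => h i hi (by push_cast; omega)
    have h2 := h (m + n) (by omega) (by push_cast; omega)
    simp only [fwdDelta] at h2
    push_cast
    rw [← add_assoc]
    linarith

/-- All points in the support of the subdivision step lie within a multiple of the discrete
tangential length `(S_q Δx)_K` of each other. -/
theorem abs_sub_bsplineSub_le {x : ℤ → ℝ} (hx : StrictMono x) (q : ℕ) (K i : ℤ)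
    (h : K / 2 ≤ i) (h' : i ≤ (K + (q + 2 : ℕ)) / 2) :
    |x i - bsplineSub (q + 2) x K|
      ≤ (q + 1) * 2 ^ q * bsplineSub q (fwdDelta x) K := by
  have hpos : ∀ i, 0 ≤ fwdDelta x i := fun i => sub_nonneg.2 (hx (lt_add_one i)).le
  have hc := bsplineSub_nonneg q _ K hpos
  obtain ⟨n, hn⟩ := Int.le.dest (show K / 2 ≤ (K + (q + 2 : ℕ)) / 2 by omega)
  have hwid : x ((K + (q + 2 : ℕ)) / 2) - x (K / 2)
      ≤ (q + 1) * 2 ^ q * bsplineSub q (fwdDelta x) K := by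
    have h1 := sub_le_mul_of_fwdDelta_le (x := x)
      (a := 2 ^ q * bsplineSub q (fwdDelta x) K) (K / 2) n
      fun i hi hi' => le_two_pow_mul_bsplineSub q _ hpos K i hi (by push_cast at hn; omega)
    rw [hn] at h1
    have h2 : (n : ℝ) ≤ q + 1 := by
      have : n ≤ q + 1 := by push_cast at hn; omega
      exact_mod_cast this
    have h3 : (n : ℝ) * (2 ^ q * bsplineSub q (fwdDelta x) K)
        ≤ (q + 1) * (2 ^ q * bsplineSub q (fwdDelta x) K) := by gcongr
    linarith
  have hy := bsplineSub_mem_of_convex (convex_Icc (x (K / 2)) (x ((K + (q + 2 : ℕ)) / 2)))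
    (q + 2) x K fun i hi hi' => ⟨hx.monotone hi, hx.monotone hi'⟩
  have h1 := hx.monotone h
  have h2 := hx.monotone h'
  rw [abs_le]
  constructor <;> linarith [hy.1, hy.2]

theorem inner_approxNormal (q : ℕ) (w : ℤ → Plane) (K : ℤ) :
    inner ℝ (approxNormal q w K) (bsplineSub q (fwdDelta w) K) = (0 : ℝ) := by
  have h : ∀ u : Plane, inner ℝ (perp u) u = (0 : ℝ) := fun u => by
    simp [perp, PiLp.inner_apply, Fin.sum_univ_two]; ring
  rw [approxNormal, real_inner_smul_left, h, mul_zero]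

/-- The local estimate behind the theorem: the offset is controlled by the discrete tangential
length `c = (S_q Δx)_K`, the asymmetry `(S_q Δz²)_K` of the discrete tangent and the third
moment `(S_{q+2} z³)_K`, where `z = x - (S_{q+2} x)_K`. -/
theorem BoundedDerivs.exists_abs_offset_le {v v₁ v₂ v₃ : ℝ → Plane} {B : ℝ}
    (hB : BoundedDerivs v v₁ v₂ v₃ B) (q : ℕ) :
    ∃ C δ : ℝ, 0 ≤ C ∧ 0 < δ ∧ ∀ (x : ℤ → ℝ) (K : ℤ) (s D : ℝ), StrictMono x →
      v s = bsplineSub (q + 2) (fun i => v (x i)) K + D • approxNormal q (fun i => v (x i)) K →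
      bsplineSub q (fwdDelta x) K ≤ δ → |s - bsplineSub (q + 2) x K| ≤ δ →
      |s - bsplineSub (q + 2) x K| ≤ C * (bsplineSub q (fwdDelta x) K ^ 4
        + bsplineSub q (fwdDelta x) K *
          |bsplineSub q (fwdDelta fun i => (x i - bsplineSub (q + 2) x K) ^ 2) K|
        + |bsplineSub (q + 2) (fun i => (x i - bsplineSub (q + 2) x K) ^ 3) K|) := by
  set A : ℝ := (q + 1) * 2 ^ q with hA
  have hA1 : 1 ≤ A := by
    have h1 : (1 : ℝ) ≤ 2 ^ q := one_le_pow₀ (by norm_num)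
    have h2 : (0 : ℝ) ≤ q := Nat.cast_nonneg q
    nlinarith
  set Q : ℝ := 2 * B * A ^ 4 with hQdef
  have hB1 := hB.one_le
  have hA2 : 1 ≤ A ^ 2 := one_le_pow₀ hA1
  have hA4 : 1 ≤ A ^ 4 := one_le_pow₀ hA1
  have hBQ : 2 * B ≤ Q := by rw [hQdef]; nlinarith
  have hQ1 : 1 ≤ Q := by linarith
  have hA24 : A ^ 2 ≤ A ^ 4 := pow_le_pow_right₀ hA1 (by norm_num)
  have hA34 : A ^ 3 ≤ A ^ 4 := pow_le_pow_right₀ hA1 (by norm_num)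
  have hA2Q : A ^ 2 ≤ Q := by rw [hQdef]; nlinarith
  have hA3Q : 2 * B * A ^ 3 ≤ Q := by rw [hQdef]; gcongr
  have hA4Q : B * A ^ 4 ≤ Q := by rw [hQdef]; nlinarith
  refine ⟨8 * Q ^ 3, 1 / (8 * Q ^ 3), by positivity, by positivity, ?_⟩
  intro x K s D hx hstep hc hw
  set c := bsplineSub q (fwdDelta x) K with hcdef
  set y := bsplineSub (q + 2) x K with hy
  have hpos : ∀ i, 0 ≤ fwdDelta x i := fun i => sub_nonneg.2 (hx (lt_add_one i)).le
  have hc0 : 0 < c := by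
    have h1 := le_two_pow_mul_bsplineSub q _ hpos K (K / 2) le_rfl (by omega)
    have h2 : 0 < fwdDelta x (K / 2) := sub_pos.2 (hx (lt_add_one _))
    have h3 : (0 : ℝ) < 2 ^ q := by positivity
    exact pos_of_mul_pos_right (h2.trans_le h1) h3.le
  have hz : ∀ i, K / 2 ≤ i → i ≤ (K + (q + 2 : ℕ)) / 2 → |x i - y| ≤ A * c :=
    fun i h h' => abs_sub_bsplineSub_le hx q K i h h'
  -- Taylor expansion of the new point of the linear scheme
  have hS : bsplineSub (q + 2) (fun i => v (x i)) K = v y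
      + bsplineSub (q + 2) (fun i => (x i - y) ^ 2) K • (1 / 2 : ℝ) • v₂ y
      + bsplineSub (q + 2) (fun i => (x i - y) ^ 3) K • (1 / 6 : ℝ) • v₃ y
      + bsplineSub (q + 2) (fun i => v (x i) - v y - (x i - y) • v₁ y
        - (x i - y) ^ 2 • (1 / 2 : ℝ) • v₂ y - (x i - y) ^ 3 • (1 / 6 : ℝ) • v₃ y) K := by
    rw [bsplineSub_sub, bsplineSub_sub, bsplineSub_sub, bsplineSub_sub, bsplineSub_const,
      bsplineSub_smul_const, bsplineSub_smul_const, bsplineSub_smul_const, bsplineSub_sub,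
      bsplineSub_const, ← hy, sub_self, zero_smul]
    abel
  -- and of the discrete tangent
  have hW : bsplineSub q (fwdDelta fun i => v (x i)) K = c • v₁ y
      + bsplineSub q (fwdDelta fun i => (x i - y) ^ 2) K • (1 / 2 : ℝ) • v₂ y
      + bsplineSub q (fwdDelta fun i => v (x i) - v y - (x i - y) • v₁ y
        - (x i - y) ^ 2 • (1 / 2 : ℝ) • v₂ y) K := by
    rw [hcdef, ← bsplineSub_smul_const, ← bsplineSub_smul_const, ← bsplineSub_add,
      ← bsplineSub_add]
    congr 1
    funext i
    simp only [fwdDelta]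
    module
  have hzpow : ∀ n : ℕ, ∀ i, K / 2 ≤ i → i ≤ (K + (q + 2 : ℕ)) / 2 →
      |x i - y| ^ n ≤ A ^ n * c ^ n := fun n i h h' => by
    rw [← mul_pow]; exact pow_le_pow_left₀ (abs_nonneg _) (hz i h h') n
  have hin := inner_approxNormal q (fun i => v (x i)) K
  have hD : v s - bsplineSub (q + 2) (fun i => v (x i)) K
      = D • approxNormal q (fun i => v (x i)) K := by rw [hstep]; abel
  have hin2 : inner ℝ (v s - bsplineSub (q + 2) (fun i => v (x i)) K)
      (bsplineSub q (fwdDelta fun i => v (x i)) K) = (0 : ℝ) := by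
    rw [hD, real_inner_smul_left, hin, mul_zero]
  rw [hS, hW] at hin2
  have hc' : 8 * Q ^ 3 * c ≤ 1 := by
    rw [le_div_iff₀ (by positivity)] at hc; linarith
  have hw' : 8 * Q ^ 3 * |s - y| ≤ 1 := by
    rw [le_div_iff₀ (by positivity)] at hw; linarith
  have main := abs_le_of_inner_eq_zero (T := v₁ y) (a₂ := v₂ y) (a₃ := v₃ y)
    (r := v s - v y - (s - y) • v₁ y)
    (R := bsplineSub (q + 2) (fun i => v (x i) - v y - (x i - y) • v₁ y
        - (x i - y) ^ 2 • (1 / 2 : ℝ) • v₂ y - (x i - y) ^ 3 • (1 / 6 : ℝ) • v₃ y) K)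
    (R' := bsplineSub q (fwdDelta fun i => v (x i) - v y - (x i - y) • v₁ y
        - (x i - y) ^ 2 • (1 / 2 : ℝ) • v₂ y) K)
    (w := s - y) (m₂ := bsplineSub (q + 2) (fun i => (x i - y) ^ 2) K / 2)
    (m₃ := bsplineSub (q + 2) (fun i => (x i - y) ^ 3) K / 6)
    (e := bsplineSub q (fwdDelta fun i => (x i - y) ^ 2) K / 2) (c := c) (Q := Q)
    hQ1 (hB.norm_one y) (hB.inner_eq_zero y) ((hB.norm_two y).trans (by linarith))
    ((hB.norm_three y).trans (by linarith)) hc0 hc' hw'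
    ((hB.taylor_one y s).trans (by gcongr; linarith)) ?_ ?_ ?_ ?_ ?_
  · refine main.trans ?_
    rw [abs_div, abs_div, abs_of_pos (show (0 : ℝ) < 2 by norm_num),
      abs_of_pos (show (0 : ℝ) < 6 by norm_num)]
    gcongr <;> exact div_le_self (abs_nonneg _) (by norm_num)
  · rw [abs_div, abs_of_pos (show (0 : ℝ) < 2 by norm_num)]
    refine (div_le_self (abs_nonneg _) (by norm_num)).trans (abs_bsplineSub_le _ _ _ ?_)
    intro i h h'
    rw [abs_pow]
    exact (hzpow 2 i h h').trans (by gcongr)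
  · refine norm_bsplineSub_le _ _ _ fun i h h' => (hB.taylor_three y (x i)).trans ?_
    calc B * |x i - y| ^ 4 ≤ B * (A ^ 4 * c ^ 4) := by
          have := hB.nonneg
          gcongr
          exact hzpow 4 i h h'
      _ = (B * A ^ 4) * c ^ 4 := by ring
      _ ≤ Q * c ^ 4 := by gcongr
  · refine norm_bsplineSub_le _ _ _ fun i h h' => ?_
    have t : ∀ i, K / 2 ≤ i → i ≤ (K + (q + 2 : ℕ)) / 2 → ‖v (x i) - v y - (x i - y) • v₁ y
        - (x i - y) ^ 2 • (1 / 2 : ℝ) • v₂ y‖ ≤ B * (A ^ 3 * c ^ 3) := fun i h h' =>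
      (hB.taylor_two y (x i)).trans (by
        have := hB.nonneg
        gcongr
        exact hzpow 3 i h h')
    have t1 := t i h (by push_cast; omega)
    have t2 := t (i + 1) (by omega) (by push_cast; omega)
    calc _ ≤ B * (A ^ 3 * c ^ 3) + B * (A ^ 3 * c ^ 3) := (norm_sub_le _ _).trans (add_le_add t2 t1)
      _ = (2 * B * A ^ 3) * c ^ 3 := by ring
      _ ≤ Q * c ^ 3 := by gcongr
  · rw [abs_div, abs_of_pos (show (0 : ℝ) < 2 by norm_num), div_le_iff₀ (by norm_num)]
    refine abs_bsplineSub_le _ _ _ fun i h h' => ?_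
    have t1 := hzpow 2 i h (by push_cast; omega)
    have t2 := hzpow 2 (i + 1) (by omega) (by push_cast; omega)
    have t3 : A ^ 2 * c ^ 2 ≤ Q * c ^ 2 := by gcongr
    rw [sq_abs] at t1 t2
    simp only [fwdDelta]
    rw [abs_le]
    constructor <;> nlinarith [sq_nonneg (x i - y), sq_nonneg (x (i + 1) - y)]
  · rw [← hin2]
    congr 1 <;> module

theorem abs_sub_add_mul_le_of_fwdDelta_two {x : ℤ → ℝ} {g : ℝ}
    (hg : ∀ i, |fwdDelta (fwdDelta x) i| ≤ g) (m : ℤ) (n : ℕ) :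
    |x (m + n) - x m - n * fwdDelta x m| ≤ n ^ 2 * g := by
  have hg0 : 0 ≤ g := (abs_nonneg _).trans (hg 0)
  have h1 : ∀ n : ℕ, |fwdDelta x (m + n) - fwdDelta x m| ≤ n * g := by
    intro n
    induction n with
    | zero => simp
    | succ n ih =>
      have h := hg (m + n)
      rw [fwdDelta] at h
      rw [abs_le] at *
      push_cast
      rw [← add_assoc]
      constructor <;> linarith
  induction n with
  | zero => simp
  | succ n ih =>
    have h := h1 n
    have hx : fwdDelta x (m + n) = x (m + n + 1) - x (m + n) := rfl
    have h3 : 0 ≤ (n : ℝ) * g := by positivity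
    rw [hx] at h
    rw [abs_le] at *
    push_cast
    rw [← add_assoc]
    constructor <;> linarith

/-- When the second differences are small, so are the asymmetry of the discrete tangent and the
third moment: both vanish on linear sequences, because `S_{q+2}` has no third central moment and
`S_q Δ` is centred at the same point as `S_{q+2}`. -/
theorem exists_abs_moments_le (q : ℕ) (hq : 1 ≤ q) :
    ∃ C : ℝ, 0 ≤ C ∧ ∀ (x : ℤ → ℝ) (K : ℤ) (g : ℝ), StrictMono x →
      (∀ i, |fwdDelta (fwdDelta x) i| ≤ g) →
      |bsplineSub q (fwdDelta fun i => (x i - bsplineSub (q + 2) x K) ^ 2) K|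
        ≤ C * (bsplineSub q (fwdDelta x) K * g) ∧
      |bsplineSub (q + 2) (fun i => (x i - bsplineSub (q + 2) x K) ^ 3) K|
        ≤ C * (bsplineSub q (fwdDelta x) K ^ 2 * g) := by
  set A : ℝ := (q + 2) * 2 ^ q with hA
  have hA0 : 0 ≤ A := by positivity
  set G : ℝ := 2 * (q + 2) ^ 2 with hG
  have hG0 : 0 ≤ G := by positivity
  refine ⟨4 * A * G + 3 * A ^ 2 * G, by positivity, fun x K g hx hg => ?_⟩
  set c := bsplineSub q (fwdDelta x) K with hcdef
  set y := bsplineSub (q + 2) x K with hy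
  have hg0 : 0 ≤ g := (abs_nonneg _).trans (hg 0)
  have hpos : ∀ i, 0 ≤ fwdDelta x i := fun i => sub_nonneg.2 (hx (lt_add_one i)).le
  have hc0 : 0 ≤ c := bsplineSub_nonneg q _ K hpos
  have hz : ∀ i, K / 2 ≤ i → i ≤ (K + (q + 2 : ℕ)) / 2 → |x i - y| ≤ A * c := fun i h h' =>
    (abs_sub_bsplineSub_le hx q K i h h').trans (by
      rw [hA]; gcongr; norm_num)
  set β := fwdDelta x (K / 2) with hβ
  have hβc : β ≤ 2 ^ q * c := le_two_pow_mul_bsplineSub q _ hpos K (K / 2) le_rfl (by omega)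
  have hβ0 : 0 ≤ β := hpos _
  set κ : ℝ := K / 2 + (q + 1) / 4 with hκ
  have hidx : ∀ i, K / 2 ≤ i → i ≤ (K + (q + 2 : ℕ)) / 2 → |(i : ℝ) - κ| ≤ q + 2 := by
    intro i h h'
    have h1 : K ≤ 2 * i + 1 := by omega
    have h2 : 2 * i ≤ K + q + 2 := by push_cast at h'; omega
    have h1' : (K : ℝ) ≤ 2 * i + 1 := by exact_mod_cast h1
    have h2' : 2 * (i : ℝ) ≤ K + q + 2 := by exact_mod_cast h2
    have hq' : (0 : ℝ) ≤ q := Nat.cast_nonneg q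
    rw [abs_le]; constructor <;> rw [hκ] <;> linarith
  have hβℓ : ∀ i, K / 2 ≤ i → i ≤ (K + (q + 2 : ℕ)) / 2 → |β * ((i : ℝ) - κ)| ≤ A * c := by
    intro i h h'
    rw [abs_mul, abs_of_nonneg hβ0]
    calc β * |(i : ℝ) - κ| ≤ (2 ^ q * c) * (q + 2) := by
          gcongr
          exact hidx i h h'
      _ = A * c := by rw [hA]; ring
  set ρ : ℤ → ℝ := fun i => x i - x (K / 2) - ((i : ℝ) - (K / 2 : ℤ)) * β with hρ
  have hρb : ∀ i, K / 2 ≤ i → i ≤ (K + (q + 2 : ℕ)) / 2 → |ρ i| ≤ (q + 2) ^ 2 * g := by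
    intro i h h'
    obtain ⟨n, rfl⟩ := Int.le.dest h
    have h1 := abs_sub_add_mul_le_of_fwdDelta_two hg (K / 2) n
    have h2 : (n : ℝ) ≤ q + 2 := by
      have : n ≤ q + 2 := by push_cast at h'; omega
      exact_mod_cast this
    have h3 : ρ (K / 2 + n) = x (K / 2 + n) - x (K / 2) - n * β := by
      simp only [hρ]; push_cast; ring
    rw [h3]
    exact h1.trans (by gcongr)
  have hSρ := abs_bsplineSub_le (q + 2) ρ K hρb
  have hyρ : y = x (K / 2) + β * (κ - (K / 2 : ℤ)) + bsplineSub (q + 2) ρ K := by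
    have h1 : bsplineSub (q + 2) ρ K = y - x (K / 2) - (κ - (K / 2 : ℤ)) * β := by
      have h2 : bsplineSub (q + 2) (fun i : ℤ => ((i : ℝ) - (K / 2 : ℤ)) * β) K
          = (κ - (K / 2 : ℤ)) * β := by
        have h3 := bsplineSub_smul_const (q + 2) (fun i : ℤ => (i : ℝ) - (K / 2 : ℤ)) β K
        simp only [smul_eq_mul] at h3
        rw [h3, bsplineSub_sub, bsplineSub_const, bsplineSub_intCast _ (by omega), hκ]
        push_cast; ring
      rw [hρ, bsplineSub_sub, bsplineSub_sub, bsplineSub_const, h2]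
    rw [h1]; ring
  -- `z` is `β (i - κ)` up to a perturbation of the size of the second differences
  have hτ : ∀ i, K / 2 ≤ i → i ≤ (K + (q + 2 : ℕ)) / 2 →
      |(x i - y) - β * ((i : ℝ) - κ)| ≤ G * g := by
    intro i h h'
    have h1 : (x i - y) - β * ((i : ℝ) - κ) = ρ i - bsplineSub (q + 2) ρ K := by
      rw [hyρ]; simp only [hρ]; ring
    have h2 := hρb i h h'
    rw [h1, hG]
    rw [abs_le] at *
    constructor <;> linarith
  constructor
  · set f : ℤ → ℝ := fun i => (x i - y) ^ 2 - (β * ((i : ℝ) - κ)) ^ 2 with hf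
    have hfb : ∀ i, K / 2 ≤ i → i ≤ (K + (q + 2 : ℕ)) / 2 → |f i| ≤ G * g * (2 * (A * c)) := by
      intro i h h'
      have h1 : f i = ((x i - y) - β * ((i : ℝ) - κ)) * ((x i - y) + β * ((i : ℝ) - κ)) := by
        simp only [hf]; ring
      rw [h1, abs_mul]
      have h2 := (abs_add_le (x i - y) (β * ((i : ℝ) - κ))).trans
        (add_le_add (hz i h h') (hβℓ i h h'))
      gcongr
      · exact hτ i h h'
      · linarith
    have hlin : bsplineSub q (fun i : ℤ => β ^ 2 * (2 * (i : ℝ) - (2 * κ - 1))) K = 0 := by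
      rw [bsplineSub_const_mul, bsplineSub_sub, bsplineSub_const, bsplineSub_const_mul,
        bsplineSub_intCast _ hq, hκ]
      ring
    have hsplit : bsplineSub q (fwdDelta fun i => (x i - y) ^ 2) K
        = bsplineSub q (fwdDelta f) K := by
      rw [← add_zero (bsplineSub q (fwdDelta f) K), ← hlin, ← bsplineSub_add]
      congr 1
      funext i
      simp only [fwdDelta, hf]
      push_cast; ring
    rw [hsplit]
    have h0 : |bsplineSub q (fwdDelta f) K| ≤ 4 * A * G * (c * g) := by
      refine abs_bsplineSub_le _ _ _ fun i h h' => ?_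
      have t1 := hfb i h (by push_cast; omega)
      have t2 := hfb (i + 1) (by omega) (by push_cast; omega)
      simp only [fwdDelta]
      rw [abs_le] at *
      constructor <;> linarith
    have h1 : 0 ≤ 3 * A ^ 2 * G * (c * g) := by positivity
    linarith
  · have hcub : bsplineSub (q + 2) (fun i : ℤ => β ^ 3 * ((i : ℝ) - κ) ^ 3) K = 0 := by
      rw [bsplineSub_const_mul, bsplineSub_sub_pow_three _ (by omega), hκ]
      push_cast; ring
    have hsplit : bsplineSub (q + 2) (fun i => (x i - y) ^ 3) K
        = bsplineSub (q + 2) (fun i => (x i - y) ^ 3 - β ^ 3 * ((i : ℝ) - κ) ^ 3) K := by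
      rw [bsplineSub_sub, hcub, sub_zero]
    rw [hsplit]
    have h0 : |bsplineSub (q + 2) (fun i => (x i - y) ^ 3 - β ^ 3 * ((i : ℝ) - κ) ^ 3) K|
        ≤ 3 * A ^ 2 * G * (c ^ 2 * g) := by
      refine abs_bsplineSub_le _ _ _ fun i h h' => ?_
      have h1 : (x i - y) ^ 3 - β ^ 3 * ((i : ℝ) - κ) ^ 3 = ((x i - y) - β * ((i : ℝ) - κ)) *
          ((x i - y) * (x i - y) + (x i - y) * (β * ((i : ℝ) - κ))
            + (β * ((i : ℝ) - κ)) * (β * ((i : ℝ) - κ))) := by ring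
      have hb1 := hz i h h'
      have hb2 := hβℓ i h h'
      have h2 : |(x i - y) * (x i - y) + (x i - y) * (β * ((i : ℝ) - κ))
            + (β * ((i : ℝ) - κ)) * (β * ((i : ℝ) - κ))|
          ≤ (A * c) * (A * c) + (A * c) * (A * c) + (A * c) * (A * c) := by
        refine (abs_add_three _ _ _).trans ?_
        rw [abs_mul, abs_mul, abs_mul (β * ((i : ℝ) - κ)) (β * ((i : ℝ) - κ))]
        gcongr
      rw [h1, abs_mul]
      calc _ ≤ G * g * ((A * c) * (A * c) + (A * c) * (A * c) + (A * c) * (A * c)) := by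
            gcongr
            exact hτ i h h'
        _ = _ := by ring
    have h1 : 0 ≤ 4 * A * G * (c ^ 2 * g) := by positivity
    linarith

/-- Offsets are of third order in the mesh size `h`, and of fourth order up to the size `g` of
the second differences. -/
theorem BoundedDerivs.exists_abs_offset_le_mesh {v v₁ v₂ v₃ : ℝ → Plane} {B : ℝ}
    (hB : BoundedDerivs v v₁ v₂ v₃ B) (q : ℕ) (hq : 1 ≤ q) :
    ∃ C δ : ℝ, 0 < C ∧ 0 < δ ∧ ∀ (x : ℤ → ℝ) (K : ℤ) (s D h : ℝ), StrictMono x →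
      v s = bsplineSub (q + 2) (fun i => v (x i)) K + D • approxNormal q (fun i => v (x i)) K →
      (∀ i, |fwdDelta x i| ≤ h) → h ≤ δ → |s - bsplineSub (q + 2) x K| ≤ δ →
      |s - bsplineSub (q + 2) x K| ≤ C * h ^ 3 ∧
      ∀ g, (∀ i, |fwdDelta (fwdDelta x) i| ≤ g) →
        |s - bsplineSub (q + 2) x K| ≤ C * (h ^ 4 + h ^ 2 * g) := by
  obtain ⟨C, δ, hC, hδ, H⟩ := hB.exists_abs_offset_le q
  obtain ⟨C', hC', H'⟩ := exists_abs_moments_le q hq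
  set A : ℝ := (q + 1) * 2 ^ q with hA
  have hA0 : 0 ≤ A := by positivity
  refine ⟨C * (1 + 2 * A ^ 2 + A ^ 3) + C * (1 + 2 * C') + 1, min δ 1, by positivity,
    by positivity, ?_⟩
  intro x K s D h hx hstep hh hhδ hsδ
  have hpos : ∀ i, 0 ≤ fwdDelta x i := fun i => sub_nonneg.2 (hx (lt_add_one i)).le
  have hc0 : 0 ≤ bsplineSub q (fwdDelta x) K := bsplineSub_nonneg q _ K hpos
  have hch : bsplineSub q (fwdDelta x) K ≤ h :=
    (le_abs_self _).trans (abs_bsplineSub_le _ _ _ fun i _ _ => hh i)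
  have h1 := H x K s D hx hstep (hch.trans (hhδ.trans (min_le_left _ _)))
    (hsδ.trans (min_le_left _ _))
  have hzb : ∀ i, K / 2 ≤ i → i ≤ (K + (q + 2 : ℕ)) / 2 → _ := fun i h h' =>
    abs_sub_bsplineSub_le hx q K i h h'
  have hh1 : h ≤ 1 := hhδ.trans (min_le_right _ _)
  specialize H' x K
  set c := bsplineSub q (fwdDelta x) K with hcdef
  set y := bsplineSub (q + 2) x K with hy
  have hh0 : 0 ≤ h := hc0.trans hch
  constructor
  · have he : |bsplineSub q (fwdDelta fun i => (x i - y) ^ 2) K| ≤ 2 * (A * c) ^ 2 := by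
      refine abs_bsplineSub_le _ _ _ fun i h h' => ?_
      have t1 := pow_le_pow_left₀ (abs_nonneg _) (hzb i h (by push_cast; omega)) 2
      have t2 := pow_le_pow_left₀ (abs_nonneg _)
        (hzb (i + 1) (by omega) (by push_cast; omega)) 2
      rw [sq_abs] at t1 t2
      simp only [fwdDelta]
      have n1 := sq_nonneg (x i - y)
      have n2 := sq_nonneg (x (i + 1) - y)
      rw [abs_le]
      constructor <;> linarith
    have hm : |bsplineSub (q + 2) (fun i => (x i - y) ^ 3) K| ≤ (A * c) ^ 3 := by
      refine abs_bsplineSub_le _ _ _ fun i h h' => ?_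
      rw [abs_pow]
      exact pow_le_pow_left₀ (abs_nonneg _) (hzb i h h') 3
    have hc4 : c ^ 4 ≤ h ^ 3 := by
      calc c ^ 4 ≤ h ^ 4 := by gcongr
        _ ≤ h ^ 3 := pow_le_pow_of_le_one hh0 hh1 (by norm_num)
    calc |s - y| ≤ C * (c ^ 4 + c * (2 * (A * c) ^ 2) + (A * c) ^ 3) := h1.trans (by gcongr)
      _ = C * (c ^ 4 + (2 * A ^ 2 + A ^ 3) * c ^ 3) := by ring
      _ ≤ C * (h ^ 3 + (2 * A ^ 2 + A ^ 3) * h ^ 3) := by gcongr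
      _ ≤ _ := by
        have : 0 ≤ (C * (1 + 2 * C') + 1) * h ^ 3 := by positivity
        linarith
  · intro g hg
    have hg0 : 0 ≤ g := (abs_nonneg _).trans (hg 0)
    obtain ⟨he, hm⟩ := H' g hx hg
    calc |s - y| ≤ C * (c ^ 4 + c * (C' * (c * g)) + C' * (c ^ 2 * g)) := h1.trans (by gcongr)
      _ = C * (c ^ 4 + 2 * C' * (c ^ 2 * g)) := by ring
      _ ≤ C * (h ^ 4 + 2 * C' * (h ^ 2 * g)) := by gcongr
      _ ≤ _ := by
        have e1 : 0 ≤ (C * (1 + 2 * A ^ 2 + A ^ 3) + 1) * (h ^ 4 + h ^ 2 * g) := by positivity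
        have e2 : 0 ≤ C * (2 * C') * h ^ 4 := by positivity
        have e3 : 0 ≤ C * (h ^ 2 * g) := by positivity
        linarith

/-! ### Decay of differences under perturbed subdivision -/

theorem exists_abs_le_of_periodic {f : ℤ → ℝ} {P : ℤ} (hP : 0 < P) (hf : ∀ i, f (i + P) = f i) :
    ∃ B, ∀ i, |f i| ≤ B := by
  obtain ⟨B, hB⟩ := ((Finset.Ico 0 P).image fun i => |f i|).exists_le
  refine ⟨B, fun i => ?_⟩
  have h : f (i % P) = f i := by
    rw [Int.emod_def, mul_comm]
    simpa using Function.Periodic.sub_zsmul_eq (f := f) (c := P) hf (i / P) (x := i)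
  rw [← h]
  exact hB _ (Finset.mem_image_of_mem _
    (Finset.mem_Ico.2 ⟨Int.emod_nonneg _ hP.ne', Int.emod_lt_of_pos _ hP⟩))

/-- Finitely many levels, each of them bounded, do not affect a decay rate. -/
theorem exists_abs_le_mul_of_eventually {f : ℕ → ℤ → ℝ} {w : ℕ → ℝ} (hw : ∀ j, 0 < w j)
    (hb : ∀ j, ∃ B, ∀ K, |f j K| ≤ B) {C : ℝ} {J : ℕ}
    (h : ∀ j, J ≤ j → ∀ K, |f j K| ≤ C * w j) :
    ∃ C, 0 ≤ C ∧ ∀ j K, |f j K| ≤ C * w j := by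
  choose B hB using hb
  have hB0 : ∀ j, 0 ≤ B j := fun j => (abs_nonneg _).trans (hB j 0)
  have hsum : 0 ≤ ∑ j ∈ Finset.range J, B j / w j :=
    Finset.sum_nonneg fun j _ => div_nonneg (hB0 j) (hw j).le
  refine ⟨|C| + ∑ j ∈ Finset.range J, B j / w j, by positivity, fun j K => ?_⟩
  rcases le_or_gt J j with hj | hj
  · refine (h j hj K).trans (mul_le_mul_of_nonneg_right ?_ (hw j).le)
    linarith [le_abs_self C]
  · refine (hB j K).trans ((div_le_iff₀ (hw j)).1 ?_)
    have := Finset.single_le_sum (f := fun j => B j / w j)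
      (fun i _ => div_nonneg (hB0 i) (hw i).le) (Finset.mem_range.2 hj)
    linarith [abs_nonneg C]

theorem abs_iterate_fwdDelta_le {f : ℤ → ℝ} {B : ℝ} (hf : ∀ i, |f i| ≤ B) (k : ℕ) (i : ℤ) :
    |fwdDelta^[k] f i| ≤ 2 ^ k * B := by
  induction k generalizing i with
  | zero => simpa using hf i
  | succ k ih =>
    rw [Function.iterate_succ_apply', fwdDelta, pow_succ]
    have h1 := ih i
    have h2 := ih (i + 1)
    rw [abs_le] at *
    constructor <;> linarith

/-- Decay of the `k`-th differences of perturbed subdivision data: each step contracts them by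
`2 ^ (-k)`, and the perturbations accumulate. -/
theorem abs_iterate_fwdDelta_le_sum {x : ℕ → ℤ → ℝ} {q k : ℕ} {ω : ℕ → ℝ} {A : ℝ}
    (hω : ∀ j K, |x (j + 1) K - bsplineSub (q + k) (x j) K| ≤ ω j)
    (hA : ∀ K, |fwdDelta^[k] (x 0) K| ≤ A) (j : ℕ) (K : ℤ) :
    |fwdDelta^[k] (x j) K|
      ≤ (A + ∑ i ∈ Finset.range j, 2 ^ k * 2 ^ (k * (i + 1)) * ω i) / 2 ^ (k * j) := by
  induction j generalizing K with
  | zero => simpa using hA K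
  | succ j ih =>
    have h1 : x (j + 1) = bsplineSub (q + k) (x j)
        + fun K => x (j + 1) K - bsplineSub (q + k) (x j) K := by
      funext K; simp
    have h2 := abs_iterate_fwdDelta_le (hω j) k K
    have h3 : |bsplineSub q (fwdDelta^[k] (x j)) K|
      ≤ (A + ∑ i ∈ Finset.range j, 2 ^ k * 2 ^ (k * (i + 1)) * ω i) / 2 ^ (k * j) :=
      abs_bsplineSub_le _ _ _ fun i _ _ => ih i
    rw [h1, iterate_fwdDelta_add, iterate_fwdDelta_bsplineSub, Finset.sum_range_succ]
    simp only [Pi.add_apply, Pi.smul_apply, smul_eq_mul]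
    refine (abs_add_le _ _).trans ?_
    rw [abs_mul, abs_of_pos (by positivity : (0 : ℝ) < (1 / 2) ^ k)]
    have e1 : (2 : ℝ) ^ (k * (j + 1)) = 2 ^ (k * j) * 2 ^ k := by ring
    calc _ ≤ (1 / 2) ^ k * ((A + ∑ i ∈ Finset.range j, 2 ^ k * 2 ^ (k * (i + 1)) * ω i)
          / 2 ^ (k * j)) + 2 ^ k * ω j := by gcongr
      _ = _ := by
        rw [← add_assoc, add_div _ (2 ^ k * 2 ^ (k * (j + 1)) * ω j), e1]
        congr 1
        · rw [one_div, inv_pow]; field_simp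
        · field_simp

/-! ### Uniform convergence of monotone periodic data -/

theorem gridInterp_div_two_pow {x : ℤ → ℝ} {j M : ℕ} (h : M ≤ j) (m : ℤ) :
    gridInterp j x (m / 2 ^ M) = x (m * 2 ^ (j - M)) := by
  have h1 : (2 : ℝ) ^ j * (m / 2 ^ M) = ((m * 2 ^ (j - M) : ℤ) : ℝ) := by
    obtain ⟨n, rfl⟩ := Nat.exists_eq_add_of_le h
    rw [Nat.add_sub_cancel_left]
    push_cast
    rw [pow_add]; field_simp
  simp [gridInterp, h1, -Int.cast_mul]

theorem add_mul_period {x : ℤ → ℝ} {P : ℤ} {L : ℝ} (h : ∀ i, x (i + P) = x i + L) (k i : ℤ) :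
    x (i + k * P) = x i + k * L := by
  induction k using Int.induction_on with
  | zero => simp
  | succ k ih => rw [add_mul, ← add_assoc, one_mul, h, ih]; push_cast; ring
  | pred k ih =>
    have h1 := h (i + (-(k : ℤ) - 1) * P)
    rw [show i + (-(k : ℤ) - 1) * P + P = i + -(k : ℤ) * P by ring, ih] at h1
    push_cast at h1 ⊢
    linarith

/-- Pointwise convergence of monotone periodic data to a continuous limit is uniform. It forces
the mesh size, and the change of the data under refinement, to tend to zero uniformly. -/
theorem ConvergesTo.exists_mesh_le {s : ℕ → ℤ → ℝ} {σ : ℝ → ℝ} (hconv : ConvergesTo s σ) {N : ℕ}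
    (hN : 0 < N) {L : ℝ} (hmono : ∀ j, StrictMono (s j))
    (hper : ∀ j i, s j (i + 2 ^ j * (N : ℤ)) = s j i + L) {ε : ℝ} (hε : 0 < ε) :
    ∃ J, ∀ j, J ≤ j → ∀ K, |fwdDelta (s j) K| ≤ ε ∧ |s (j + 1) K - s j (K / 2)| ≤ ε := by
  have hlim : ∀ (M : ℕ) (m : ℤ),
      Tendsto (fun j => s j (m * 2 ^ (j - M))) atTop (𝓝 (σ (m / 2 ^ M))) := fun M m => by
    refine (hconv.tendsto (m / 2 ^ M)).congr' ?_
    filter_upwards [eventually_ge_atTop M] with j hj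
    exact gridInterp_div_two_pow hj m
  have huc := isCompact_Icc.uniformContinuousOn_of_continuous
    (s := Set.Icc (0 : ℝ) N) hconv.continuous.continuousOn
  obtain ⟨δ, hδ, hδε⟩ := Metric.uniformContinuousOn_iff.1 huc (ε / 8) (by positivity)
  obtain ⟨M, hM⟩ := exists_pow_lt_of_lt_one hδ (show (1 / 2 : ℝ) < 1 by norm_num)
  have hev : ∀ᶠ j in atTop, ∀ m ∈ Finset.Icc (0 : ℤ) (2 ^ M * N),
      |s j (m * 2 ^ (j - M)) - σ (m / 2 ^ M)| < ε / 8 := by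
    rw [Finset.eventually_all]
    intro m _
    simpa [Real.dist_eq] using Metric.tendsto_nhds.1 (hlim M m) (ε / 8) (by positivity)
  obtain ⟨J₀, hJ₀⟩ := eventually_atTop.1 hev
  have hP : (0 : ℤ) < 2 ^ M * N := by positivity
  -- reduction of a dyadic index to the fundamental period
  have hred : ∀ j, M ≤ j → ∀ m r : ℤ, s j ((m + r) * 2 ^ (j - M))
      = s j ((m % (2 ^ M * N) + r) * 2 ^ (j - M)) + (m / (2 ^ M * N) : ℤ) * L := by
    intro j hj m r
    rw [← add_mul_period (hper j)]
    congr 1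
    have h1 : (2 : ℤ) ^ j = 2 ^ M * 2 ^ (j - M) := by rw [← pow_add, Nat.add_sub_cancel' hj]
    rw [h1]
    linear_combination (-(2 : ℤ) ^ (j - M)) * Int.emod_add_mul_ediv m (2 ^ M * N)
  have hred0 : ∀ j, M ≤ j → ∀ m : ℤ, s j (m * 2 ^ (j - M))
      = s j (m % (2 ^ M * N) * 2 ^ (j - M)) + (m / (2 ^ M * N) : ℤ) * L := by
    intro j hj m
    simpa using hred j hj m 0
  have hcell : ∀ j, max J₀ M ≤ j → ∀ m : ℤ,
      s j ((m + 1) * 2 ^ (j - M)) - s j (m * 2 ^ (j - M)) ≤ ε / 2 := by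
    intro j hj m
    have hjM : M ≤ j := (le_max_right _ _).trans hj
    rw [hred j hjM m 1, hred0 j hjM m]
    have h0 := Int.emod_nonneg m hP.ne'
    have h1 := Int.emod_lt_of_pos m hP
    set m₀ := m % (2 ^ M * N) with hm₀
    have a1 := hJ₀ j ((le_max_left _ _).trans hj) m₀ (Finset.mem_Icc.2 ⟨h0, h1.le⟩)
    have a2 := hJ₀ j ((le_max_left _ _).trans hj) (m₀ + 1)
      (Finset.mem_Icc.2 ⟨by omega, by omega⟩)
    have h2 : (0 : ℝ) < 2 ^ M := by positivity
    have h0' : (0 : ℝ) ≤ m₀ := by exact_mod_cast h0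
    have h1' : (m₀ : ℝ) + 1 ≤ 2 ^ M * N := by
      have : m₀ + 1 ≤ 2 ^ M * N := by omega
      exact_mod_cast this
    have a3 := hδε ((m₀ : ℝ) / 2 ^ M) ⟨by positivity, by rw [div_le_iff₀ h2]; linarith⟩
      (((m₀ + 1 : ℤ) : ℝ) / 2 ^ M)
      ⟨by push_cast; positivity, by rw [div_le_iff₀ h2]; push_cast; linarith⟩ (by
        rw [Real.dist_eq, ← sub_div, abs_div, abs_of_pos h2]
        push_cast
        rw [show (m₀ : ℝ) - (m₀ + 1) = -1 by ring, abs_neg, abs_one]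
        rwa [one_div_pow] at hM)
    rw [Real.dist_eq] at a3
    rw [abs_lt] at a1 a2 a3
    linarith [a1.1, a2.2, a3.1]
  have hstep : ∀ j, max J₀ M ≤ j → ∀ m : ℤ,
      |s (j + 1) (m * 2 ^ (j + 1 - M)) - s j (m * 2 ^ (j - M))| ≤ ε / 2 := by
    intro j hj m
    have hjM : M ≤ j := (le_max_right _ _).trans hj
    rw [hred0 j hjM m, hred0 (j + 1) (by omega) m]
    have h0 := Int.emod_nonneg m hP.ne'
    have h1 := Int.emod_lt_of_pos m hP
    have hjJ : J₀ ≤ j := (le_max_left _ _).trans hj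
    have a1 := hJ₀ j hjJ _ (Finset.mem_Icc.2 ⟨h0, h1.le⟩)
    have a2 := hJ₀ (j + 1) (by omega) _ (Finset.mem_Icc.2 ⟨h0, h1.le⟩)
    rw [abs_lt] at a1 a2
    rw [abs_le]
    constructor <;> linarith [a1.1, a2.2, a1.2, a2.1]
  -- every index lies in a dyadic cell of level `M`
  have hloc : ∀ (j : ℕ) (K : ℤ), K / 2 ^ (j - M) * 2 ^ (j - M) ≤ K ∧
      K + 1 ≤ (K / 2 ^ (j - M) + 1) * 2 ^ (j - M) := by
    intro j K
    have h2 : (0 : ℤ) < 2 ^ (j - M) := by positivity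
    have h3 := Int.emod_add_mul_ediv K (2 ^ (j - M))
    have h4 := Int.emod_nonneg K h2.ne'
    have h5 := Int.emod_lt_of_pos K h2
    constructor <;> linarith
  refine ⟨max J₀ M, fun j hj K => ⟨?_, ?_⟩⟩
  · obtain ⟨l1, l2⟩ := hloc j K
    have h1 := (hmono j).monotone l1
    have h2 := (hmono j).monotone l2
    have h3 := hmono j (lt_add_one K)
    have h4 := hcell j hj (K / 2 ^ (j - M))
    rw [fwdDelta, abs_of_pos (sub_pos.2 h3)]
    linarith
  · obtain ⟨l1, l2⟩ := hloc j (K / 2)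
    obtain ⟨l3, l4⟩ := hloc (j + 1) K
    have hjM : M ≤ j := (le_max_right _ _).trans hj
    have hm : K / 2 / 2 ^ (j - M) = K / 2 ^ (j + 1 - M) := by
      rw [Int.ediv_ediv_of_nonneg (by norm_num), Nat.succ_sub hjM, pow_succ, mul_comm]
    rw [hm] at l1 l2
    have h1 := (hmono j).monotone l1
    have h2 := (hmono j).monotone l2
    have h3 := (hmono (j + 1)).monotone l3
    have h4 := (hmono (j + 1)).monotone l4
    have h5 := (hmono j) (lt_add_one (K / 2))
    have h6 := (hmono (j + 1)) (lt_add_one K)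
    have h7 := hcell j hj (K / 2 ^ (j + 1 - M))
    have h8 := hcell (j + 1) (by omega) (K / 2 ^ (j + 1 - M))
    have h9 := hstep j hj (K / 2 ^ (j + 1 - M))
    rw [abs_le] at h9 ⊢
    constructor <;> linarith [h9.1, h9.2]

/-! ### Decay rates of a normal transform -/

theorem Function.Periodic.deriv_real {E : Type*} [NormedAddCommGroup E] [NormedSpace ℝ E]
    {f : ℝ → E} {c : ℝ} (hf : Function.Periodic f c) : Function.Periodic (deriv f) c := fun x => by
  rw [← deriv_comp_add_const, show (fun x => f (x + c)) = f from funext hf]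

theorem Function.Periodic.exists_norm_le {E : Type*} [NormedAddCommGroup E] {f : ℝ → E} {c : ℝ}
    (hf : Function.Periodic f c) (hc : c ≠ 0) (hcont : Continuous f) : ∃ B, ∀ t, ‖f t‖ ≤ B := by
  obtain ⟨B, hB⟩ := (hf.isBounded_of_continuous hc hcont).exists_norm_le
  exact ⟨B, fun t => hB _ ⟨t, rfl⟩⟩

theorem IsClosedArcLengthCurve.exists_boundedDerivs {L : ℝ} {v : ℝ → Plane}
    (hv : IsClosedArcLengthCurve L v) (hv4 : ContDiff ℝ 4 v) :
    ∃ B, BoundedDerivs v (deriv v) (deriv (deriv v)) (deriv (deriv (deriv v))) B := by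
  have h1 : ContDiff ℝ 3 (deriv v) := (contDiff_succ_iff_deriv.1 hv4).2.2
  have h2 : ContDiff ℝ 2 (deriv (deriv v)) := (contDiff_succ_iff_deriv.1 h1).2.2
  have h3 : ContDiff ℝ 1 (deriv (deriv (deriv v))) := (contDiff_succ_iff_deriv.1 h2).2.2
  have h4 : ContDiff ℝ 0 (deriv (deriv (deriv (deriv v)))) := (contDiff_succ_iff_deriv.1 h3).2.2
  have p1 := hv.periodic.deriv_real
  have hL := hv.length_pos.ne'
  obtain ⟨B₂, hB₂⟩ := p1.deriv_real.exists_norm_le hL h2.continuous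
  obtain ⟨B₃, hB₃⟩ := p1.deriv_real.deriv_real.exists_norm_le hL h3.continuous
  obtain ⟨B₄, hB₄⟩ := p1.deriv_real.deriv_real.deriv_real.exists_norm_le hL h4.continuous
  have n2 := (norm_nonneg _).trans (hB₂ 0)
  have n3 := (norm_nonneg _).trans (hB₃ 0)
  have n4 := (norm_nonneg _).trans (hB₄ 0)
  refine ⟨1 + B₂ + B₃ + B₄, by linarith,
    fun t => (hv4.differentiable (by norm_num) t).hasDerivAt,
    fun t => (h1.differentiable (by norm_num) t).hasDerivAt,
    fun t => (h2.differentiable (by norm_num) t).hasDerivAt, hv.unit_speed,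
    fun t => (hB₂ t).trans (by linarith), fun t => (hB₃ t).trans (by linarith), fun t u => ?_⟩
  have h := convex_univ.norm_image_sub_le_of_norm_deriv_le (f := deriv (deriv (deriv v)))
    (C := B₄) (fun x _ => h3.differentiable (by norm_num) x) (fun x _ => hB₄ x)
    (Set.mem_univ t) (Set.mem_univ u)
  exact h.trans (by rw [Real.norm_eq_abs]; gcongr; linarith)

section Rates

variable {v : ℝ → Plane} {L : ℝ} {N p : ℕ} {q : ℕ} {s d : ℕ → ℤ → ℝ} {σ : ℝ → ℝ}

theorem IsWellPosedNormalMT.exists_abs_fwdDelta_le (hwp : IsWellPosedNormalMT v L N p q s d)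
    (hN : 0 < N) (j : ℕ) : ∃ B, ∀ K, |fwdDelta (s j) K| ≤ B := by
  refine exists_abs_le_of_periodic (P := 2 ^ j * (N : ℤ)) (by positivity) fun i => ?_
  have h1 := hwp.periodic j i
  have h2 := hwp.periodic j (i + 1)
  rw [add_right_comm] at h2
  simp only [fwdDelta]
  rw [h1, h2]; ring

theorem IsWellPosedNormalMT.exists_abs_fwdDelta_iterate_le
    (hwp : IsWellPosedNormalMT v L N p q s d) (hN : 0 < N) (j k : ℕ) :
    ∃ B, ∀ K, |fwdDelta^[k + 1] (s j) K| ≤ B := by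
  obtain ⟨B, hB⟩ := hwp.exists_abs_fwdDelta_le hN j
  exact ⟨_, fun K => by
    rw [Function.iterate_succ_apply]; exact abs_iterate_fwdDelta_le hB k K⟩

theorem IsWellPosedNormalMT.exists_abs_offset_le (hwp : IsWellPosedNormalMT v L N p q s d)
    (hN : 0 < N) (j : ℕ) : ∃ B, ∀ K, |offset p s (j + 1) K| ≤ B := by
  obtain ⟨B, hB⟩ := hwp.exists_abs_fwdDelta_le hN j
  obtain ⟨B', hB'⟩ := exists_abs_le_of_periodic (f := fun K => s (j + 1) K - s j (K / 2))
    (P := 2 ^ (j + 1) * (N : ℤ)) (by positivity) (fun i => by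
      have h1 : (i + 2 ^ (j + 1) * (N : ℤ)) / 2 = i / 2 + 2 ^ j * N := by
        rw [pow_succ, show i + 2 ^ j * 2 * (N : ℤ) = i + 2 ^ j * N * 2 by ring,
          Int.add_mul_ediv_right _ _ (by norm_num)]
      simp only [h1, hwp.periodic]; ring)
  refine ⟨B' + p * B, fun K => ?_⟩
  have h1 := norm_bsplineSub_sub_le p (s j) hB K
  have h2 := hB' K
  rw [Real.norm_eq_abs] at h1
  simp only [offset, Nat.add_sub_cancel]
  rw [abs_le] at *
  constructor <;> linarith

/-- The mesh size decays like `2 ^ (-j)`: a step halves it up to a cubic error, which is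
summable against the halving once the mesh is small. -/
theorem IsWellPosedNormalMT.exists_mesh_le
    (hwp : IsWellPosedNormalMT v L N (q + 2) q s d) (hN : 0 < N) {C δ : ℝ} (hC : 0 < C)
    (hδ : 0 < δ)
    (H : ∀ (j : ℕ) (K : ℤ) (h : ℝ), (∀ i, |fwdDelta (s j) i| ≤ h) → h ≤ δ →
      |offset (q + 2) s (j + 1) K| ≤ δ → |offset (q + 2) s (j + 1) K| ≤ C * h ^ 3)
    (hsmall : ∀ ε, 0 < ε → ∃ J, ∀ j, J ≤ j → ∀ K, |fwdDelta (s j) K| ≤ ε ∧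
      |offset (q + 2) s (j + 1) K| ≤ ε) :
    ∃ A, 0 ≤ A ∧ ∀ j K, |fwdDelta (s j) K| ≤ A * (1 / 2 ^ j) := by
  set ε : ℝ := min (δ / 2) (1 / (64 * C + 1)) with hε
  have hε0 : 0 < ε := by positivity
  have hε1 : 2 * ε ≤ δ := by
    have := min_le_left (δ / 2) (1 / (64 * C + 1)); linarith
  have hε2 : 64 * C * ε ^ 2 ≤ 1 := by
    have h1 : ε ≤ 1 / (64 * C + 1) := min_le_right _ _
    rw [le_div_iff₀ (by positivity)] at h1
    have h2 : 0 < 64 * C * ε := by positivity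
    have h3 : ε ≤ 1 := by linarith
    have h4 : ε * (64 * C * ε) ≤ 1 * (64 * C * ε) := by gcongr
    linarith
  obtain ⟨J, hJ⟩ := hsmall ε hε0
  -- the factor `2 - 2 ^ (-m)` leaves room for the cubic error at each step
  have key : ∀ m : ℕ, ∀ K, |fwdDelta (s (J + m)) K|
      ≤ ε * (2 - (1 / 2) ^ m) * (1 / 2) ^ m := by
    intro m
    induction m with
    | zero => intro K; simpa using (hJ J le_rfl K).1.trans (by linarith)
    | succ m ih =>
      intro K
      set u : ℝ := (1 / 2) ^ m with hu
      have hu0 : 0 < u := by positivity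
      have hu1 : u ≤ 1 := pow_le_one₀ (by norm_num) (by norm_num)
      have hh : ε * (2 - u) * u ≤ 2 * ε * u := by
        have := mul_nonneg hε0.le (mul_nonneg hu0.le hu0.le)
        linarith
      have hu2 : ε * (2 - u) * u ≤ δ := by
        have : 2 * ε * u ≤ 2 * ε * 1 := by gcongr
        linarith
      have hω : ∀ K, |offset (q + 2) s (J + m + 1) K| ≤ C * (2 * ε * u) ^ 3 := fun K => by
        refine (H (J + m) K _ ih hu2
          ((hJ (J + m) (by omega) K).2.trans (by linarith))).trans ?_
        have : 0 ≤ ε * (2 - u) * u := mul_nonneg (mul_nonneg hε0.le (by linarith)) hu0.le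
        gcongr
      have hsplit : fwdDelta (s (J + (m + 1))) K
          = (1 / 2) * bsplineSub (q + 1) (fwdDelta (s (J + m))) K
            + (offset (q + 2) s (J + m + 1) (K + 1) - offset (q + 2) s (J + m + 1) K) := by
        have h1 := fwdDelta_bsplineSub_succ (q + 1) (s (J + m)) K
        rw [smul_eq_mul] at h1
        rw [← h1]
        simp only [fwdDelta, offset, Nat.add_sub_cancel, ← add_assoc]
        ring
      have hb := abs_bsplineSub_le (q + 1) (fwdDelta (s (J + m))) K fun i _ _ => ih i
      have o1 := hω K
      have o2 := hω (K + 1)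
      have hfin : 16 * C * ε ^ 3 * u ^ 3 ≤ ε * u ^ 2 / 4 := by
        have h1 : 64 * C * ε ^ 2 * u ≤ 1 * 1 := by gcongr
        have h2 : 64 * C * ε ^ 2 * u * (ε * u ^ 2) ≤ 1 * 1 * (ε * u ^ 2) := by gcongr
        linarith
      have hpw : (1 / 2 : ℝ) ^ (m + 1) = u / 2 := by rw [pow_succ]; ring
      rw [hsplit, hpw]
      rw [abs_le] at *
      constructor <;> nlinarith
  refine (exists_abs_le_mul_of_eventually (C := 2 * ε * 2 ^ J) (J := J) (w := fun j => 1 / 2 ^ j)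
    (fun j => by positivity) (hwp.exists_abs_fwdDelta_le hN) ?_)
  intro j hj K
  obtain ⟨m, rfl⟩ := Nat.exists_eq_add_of_le hj
  refine (key m K).trans ?_
  have h1 : 2 * ε * 2 ^ J * (1 / 2 ^ (J + m)) = ε * 2 * (1 / 2) ^ m := by
    rw [pow_add, one_div_pow]; field_simp
  rw [h1]
  gcongr
  have : (0 : ℝ) < (1 / 2) ^ m := by positivity
  linarith

/-- Rates of decay: the offsets are `O(16 ^ (-j))`, and the `k`-th differences, `k ≤ 4`, are
`O(j 2 ^ (-k j))`. -/
theorem IsWellPosedNormalMT.exists_rates (hv : IsClosedArcLengthCurve L v)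
    (hv4 : ContDiff ℝ 4 v) (hN : 0 < N) (hq : 2 ≤ q)
    (hwp : IsWellPosedNormalMT v L N (q + 2) q s d) (hconv : ConvergesTo s σ) :
    ∃ C, 0 ≤ C ∧ (∀ j K, |offset (q + 2) s (j + 1) K| ≤ C * (1 / 16 ^ j)) ∧
      ∀ k, 1 ≤ k → k ≤ 4 → ∀ j K,
        |fwdDelta^[k] (s j) K| ≤ C * ((j + 1) / 2 ^ (k * j)) := by
  obtain ⟨B, hB⟩ := hv.exists_boundedDerivs hv4
  obtain ⟨C, δ, hC, hδ, H⟩ := hB.exists_abs_offset_le_mesh q (by omega)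
  have Hloc : ∀ (j : ℕ) (K : ℤ) (h : ℝ), (∀ i, |fwdDelta (s j) i| ≤ h) → h ≤ δ →
      |offset (q + 2) s (j + 1) K| ≤ δ → |offset (q + 2) s (j + 1) K| ≤ C * h ^ 3 ∧
      ∀ g, (∀ i, |fwdDelta (fwdDelta (s j)) i| ≤ g) →
        |offset (q + 2) s (j + 1) K| ≤ C * (h ^ 4 + h ^ 2 * g) :=
    fun j K h hh hhδ ho => H (s j) K (s (j + 1) K) (d (j + 1) K) h (hwp.strictMono j)
      (hwp.step j K) hh hhδ ho
  have hsmall : ∀ ε, 0 < ε → ∃ J, ∀ j, J ≤ j → ∀ K, |fwdDelta (s j) K| ≤ ε ∧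
      |offset (q + 2) s (j + 1) K| ≤ ε := by
    intro ε hε
    obtain ⟨J, hJ⟩ := hconv.exists_mesh_le hN hwp.strictMono hwp.periodic
      (show 0 < ε / (q + 3) by positivity)
    refine ⟨J, fun j hj K => ⟨(hJ j hj K).1.trans (div_le_self hε.le (by
      have : (0 : ℝ) ≤ q := Nat.cast_nonneg q
      linarith)), ?_⟩⟩
    have h1 := norm_bsplineSub_sub_le (q + 2) (s j) (fun i => (hJ j hj i).1) K
    have h2 := (hJ j hj K).2
    have h3 : ε = ((q + 2 : ℕ) : ℝ) * (ε / (q + 3)) + ε / (q + 3) := by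
      have : (0 : ℝ) < q + 3 := by positivity
      field_simp; push_cast; ring
    rw [Real.norm_eq_abs] at h1
    simp only [offset, Nat.add_sub_cancel]
    rw [abs_le] at *
    constructor <;> linarith
  obtain ⟨A, hA, hmesh⟩ := hwp.exists_mesh_le hN hC hδ
    (fun j K h hh hhδ ho => (Hloc j K h hh hhδ ho).1) hsmall
  obtain ⟨J₀, hJ₀⟩ := hsmall δ hδ
  obtain ⟨J₁, hJ₁⟩ : ∃ J₁ : ℕ, ∀ j, J₁ ≤ j → A * (1 / 2 ^ j) ≤ δ := by
    have h1 : Tendsto (fun j : ℕ => A * (1 / 2 : ℝ) ^ j) atTop (𝓝 (A * 0)) :=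
      (tendsto_pow_atTop_nhds_zero_of_lt_one (by norm_num) (by norm_num)).const_mul A
    rw [mul_zero] at h1
    obtain ⟨J₁, h⟩ := eventually_atTop.1 (h1.eventually (ge_mem_nhds hδ))
    exact ⟨J₁, fun j hj => by simpa [one_div_pow] using h j hj⟩
  -- third order decay of the offsets
  obtain ⟨W, hW, hoff3⟩ := exists_abs_le_mul_of_eventually (f := fun j => offset (q + 2) s (j + 1))
    (C := C * A ^ 3) (J := max J₀ J₁) (w := fun j => 1 / 8 ^ j) (fun j => by positivity)
    (hwp.exists_abs_offset_le hN) (fun j hj K => by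
      refine (Hloc j K _ (hmesh j) (hJ₁ j ((le_max_right _ _).trans hj))
        (hJ₀ j ((le_max_left _ _).trans hj) K).2).1.trans (le_of_eq ?_)
      rw [mul_pow, one_div_pow, ← pow_mul, mul_comm j 3, pow_mul]; norm_num; ring)
  -- hence the second differences decay like `4 ^ (-j)`
  obtain ⟨A₂, hA₂⟩ := hwp.exists_abs_fwdDelta_iterate_le hN 0 1
  have hA₂0 : 0 ≤ A₂ := (abs_nonneg _).trans (hA₂ 0)
  have hsec : ∀ j K, |fwdDelta (fwdDelta (s j)) K| ≤ (A₂ + 32 * W) * (1 / 4 ^ j) := by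
    intro j K
    have h1 := abs_iterate_fwdDelta_le_sum (x := s) (q := q) (k := 2) hoff3 hA₂ j K
    have h2 : ∑ i ∈ Finset.range j, (2 : ℝ) ^ 2 * 2 ^ (2 * (i + 1)) * (W * (1 / 8 ^ i))
        ≤ 32 * W := by
      have h3 : ∀ i : ℕ, (2 : ℝ) ^ 2 * 2 ^ (2 * (i + 1)) * (W * (1 / 8 ^ i))
          = 16 * W * (1 / 2) ^ i := fun i => by
        have e1 : (8 : ℝ) ^ i = 2 ^ i * 4 ^ i := by rw [← mul_pow]; norm_num
        have e2 : (2 : ℝ) ^ (2 * (i + 1)) = 4 * 4 ^ i := by rw [pow_mul, pow_succ]; norm_num; ring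
        rw [e1, e2, one_div_pow]
        field_simp; ring
      simp only [h3]
      rw [← Finset.mul_sum]
      have := mul_le_mul_of_nonneg_left (sum_geometric_two_le j) (show 0 ≤ 16 * W by positivity)
      linarith
    refine h1.trans ?_
    rw [mul_one_div, show (2 : ℝ) ^ (2 * j) = 4 ^ j by rw [pow_mul]; norm_num]
    gcongr
  -- and the offsets gain one order
  obtain ⟨V, hV, hoff4⟩ := exists_abs_le_mul_of_eventually (f := fun j => offset (q + 2) s (j + 1))
    (C := C * (A ^ 4 + A ^ 2 * (A₂ + 32 * W))) (J := max J₀ J₁) (w := fun j => 1 / 16 ^ j)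
    (fun j => by positivity)
    (hwp.exists_abs_offset_le hN) (fun j hj K => by
      refine ((Hloc j K _ (hmesh j) (hJ₁ j ((le_max_right _ _).trans hj))
        (hJ₀ j ((le_max_left _ _).trans hj) K).2).2 _ (hsec j)).trans (le_of_eq ?_)
      have e1 : (16 : ℝ) ^ j = (2 ^ j) ^ 4 := by
        rw [← pow_mul, mul_comm j 4, pow_mul]; norm_num
      have e2 : (4 : ℝ) ^ j = (2 ^ j) ^ 2 := by
        rw [← pow_mul, mul_comm j 2, pow_mul]; norm_num
      rw [e1, e2]; field_simp)
  have hkb : ∀ k, ∃ B, ∀ K, |fwdDelta^[k + 1] (s 0) K| ≤ B :=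
    hwp.exists_abs_fwdDelta_iterate_le hN 0
  choose D hD using hkb
  have hD0 : ∀ k, 0 ≤ D k := fun k => (abs_nonneg _).trans (hD k 0)
  refine ⟨D 0 + D 1 + D 2 + D 3 + 256 * V, by
    have := hD0 0; have := hD0 1; have := hD0 2; have := hD0 3; positivity, ?_, ?_⟩
  · intro j K
    refine (hoff4 j K).trans ?_
    gcongr
    linarith [hD0 0, hD0 1, hD0 2, hD0 3]
  · intro k hk1 hk4 j K
    obtain ⟨n, rfl⟩ := Nat.exists_eq_add_of_le' hk1
    obtain ⟨r, hr⟩ := Nat.exists_eq_add_of_le (show n + 1 ≤ q + 2 by omega)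
    have hoff : ∀ j K, |s (j + 1) K - bsplineSub (r + (n + 1)) (s j) K| ≤ V * (1 / 16 ^ j) := by
      rw [add_comm r, ← hr]; exact hoff4
    refine (abs_iterate_fwdDelta_le_sum (x := s) hoff (hD n) j K).trans ?_
    rw [mul_div_assoc']
    have h2 : ∑ i ∈ Finset.range j, (2 : ℝ) ^ (n + 1) * 2 ^ ((n + 1) * (i + 1))
        * (V * (1 / 16 ^ i)) ≤ j * (256 * V) := by
      have h3 : ∀ i ∈ Finset.range j, (2 : ℝ) ^ (n + 1) * 2 ^ ((n + 1) * (i + 1))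
          * (V * (1 / 16 ^ i)) ≤ 256 * V := fun i _ => by
        have e1 : (2 : ℝ) ^ (n + 1) ≤ 2 ^ 4 := pow_le_pow_right₀ (by norm_num) hk4
        have e2 : (2 : ℝ) ^ ((n + 1) * (i + 1)) ≤ 2 ^ (4 * (i + 1)) :=
          pow_le_pow_right₀ (by norm_num) (by gcongr)
        calc _ ≤ (2 : ℝ) ^ 4 * 2 ^ (4 * (i + 1)) * (V * (1 / 16 ^ i)) := by gcongr
          _ = 256 * V := by
            rw [pow_mul, pow_succ (2 ^ 4) i]; norm_num; field_simp; ring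
      simpa using Finset.sum_le_card_nsmul _ _ _ h3
    have hDn : D n ≤ D 0 + D 1 + D 2 + D 3 := by
      have := hD0 0; have := hD0 1; have := hD0 2; have := hD0 3
      have hn : n ≤ 3 := by omega
      interval_cases n <;> linarith
    have hj : (0 : ℝ) ≤ j := Nat.cast_nonneg j
    have h4 : 0 ≤ (D 0 + D 1 + D 2 + D 3) * j := mul_nonneg ((hD0 n).trans hDn) hj
    gcongr
    linarith

end Rates

/-! ### Limits of grid data and their derivatives -/

theorem abs_sub_le_of_abs_fwdDelta_le {y : ℤ → ℝ} {D : ℝ} (hy : ∀ i, |fwdDelta y i| ≤ D)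
    (m n : ℤ) : |y m - y n| ≤ |(m : ℝ) - n| * D := by
  have key : ∀ (n : ℤ) (k : ℕ), |y (n + k) - y n| ≤ k * D := by
    intro n k
    induction k with
    | zero => simp
    | succ k ih =>
      have h := hy (n + k)
      rw [fwdDelta] at h
      push_cast
      rw [← add_assoc]
      rw [abs_le] at *
      constructor <;> linarith
  rcases le_total n m with h | h
  · obtain ⟨k, rfl⟩ := Int.le.dest h
    simpa using key n k
  · obtain ⟨k, rfl⟩ := Int.le.dest h
    rw [abs_sub_comm, abs_sub_comm (m : ℝ)]
    simpa using key m k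

theorem floor_two_pow_succ_mul_div_two (j : ℕ) (t : ℝ) :
    ⌊2 ^ (j + 1) * t⌋ / 2 = ⌊2 ^ j * t⌋ := by
  have h := Int.floor_div_natCast (2 ^ (j + 1) * t) 2
  rw [pow_succ, Nat.cast_ofNat, Nat.cast_ofNat] at h
  rw [pow_succ, ← h]
  congr 1
  ring

theorem abs_floor_div_sub_le (j : ℕ) (t : ℝ) : |(⌊2 ^ j * t⌋ : ℝ) / 2 ^ j - t| ≤ 1 / 2 ^ j := by
  have h2 : (0 : ℝ) < 2 ^ j := by positivity
  have h : (⌊2 ^ j * t⌋ : ℝ) / 2 ^ j - t = (⌊2 ^ j * t⌋ - 2 ^ j * t) / 2 ^ j := by field_simp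
  rw [h, abs_div, abs_of_pos h2]
  gcongr
  rw [abs_le]
  constructor <;> linarith [Int.floor_le (2 ^ j * t), Int.lt_floor_add_one (2 ^ j * t)]

theorem tendsto_floor_two_pow_mul_div (t : ℝ) :
    Tendsto (fun j : ℕ => (⌊2 ^ j * t⌋ : ℝ) / 2 ^ j) atTop (𝓝 t) := by
  rw [tendsto_iff_dist_tendsto_zero]
  refine squeeze_zero (fun _ => dist_nonneg) (fun j => abs_floor_div_sub_le j t) ?_
  simpa [one_div_pow] using
    tendsto_pow_atTop_nhds_zero_of_lt_one (r := (1 / 2 : ℝ)) (by norm_num) (by norm_num)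

theorem tendsto_succ_div_two_pow :
    Tendsto (fun j : ℕ => ((j : ℝ) + 1) / 2 ^ j) atTop (𝓝 0) := by
  have h1 := tendsto_self_mul_const_pow_of_lt_one (r := (1 / 2 : ℝ)) (by norm_num) (by norm_num)
  have h2 := tendsto_pow_atTop_nhds_zero_of_lt_one (r := (1 / 2 : ℝ)) (by norm_num) (by norm_num)
  have h3 := h1.add h2
  rw [add_zero] at h3
  refine h3.congr fun j => ?_
  rw [one_div_pow]; ring

/-- Grid data whose mesh differences and refinement increments are `O(j 2 ^ (-j))` converge at
that rate, and the limit has a modulus of continuity of the type `d log (1 / d)`. -/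
theorem exists_limit_of_refinement {y : ℕ → ℤ → ℝ} {D : ℝ} (hD : 0 ≤ D)
    (h1 : ∀ j K, |fwdDelta (y j) K| ≤ D * ((j + 1) / 2 ^ j))
    (h2 : ∀ j K, |y (j + 1) K - y j (K / 2)| ≤ D * ((j + 1) / 2 ^ j)) :
    ∃ g : ℝ → ℝ, (∀ j t, |y j ⌊2 ^ j * t⌋ - g t| ≤ 4 * D * ((j + 1) / 2 ^ j)) ∧
      ∀ (j : ℕ) t u, |g t - g u| ≤ D * (j + 1) * (|t - u| + 9 / 2 ^ j) := by
  -- the tails of the series of increments are dominated by `φ`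
  set φ : ℕ → ℝ := fun j => 2 * D * ((j + 2) / 2 ^ j) with hφ
  have hφ0 : ∀ j, 0 ≤ φ j := fun j => by simp only [hφ]; positivity
  have hφs : ∀ j, φ j - φ (j + 1) = D * ((j + 1) / 2 ^ j) := fun j => by
    simp only [hφ]; push_cast; rw [pow_succ]; field_simp; ring
  have hstep : ∀ (t : ℝ) (j : ℕ), |y (j + 1) ⌊2 ^ (j + 1) * t⌋ - y j ⌊2 ^ j * t⌋| ≤ φ j - φ (j + 1) := by
    intro t j
    rw [hφs, ← floor_two_pow_succ_mul_div_two j t]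
    exact h2 j _
  have hlim : ∀ t : ℝ, ∃ l, ∀ j, |y j ⌊2 ^ j * t⌋ - l| ≤ φ j := by
    intro t
    have hm : Monotone fun j => y j ⌊2 ^ j * t⌋ - φ j := monotone_nat_of_le_succ fun j => by
      have := (abs_le.1 (hstep t j)).1; linarith
    have ha : Antitone fun j => y j ⌊2 ^ j * t⌋ + φ j := antitone_nat_of_succ_le fun j => by
      have := (abs_le.1 (hstep t j)).2; linarith
    have hmem := hm.ciSup_mem_iInter_Icc_of_antitone ha fun j => by
      have := hφ0 j; linarith
    refine ⟨⨆ j, (y j ⌊2 ^ j * t⌋ - φ j), fun j => ?_⟩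
    have hj := Set.mem_iInter.1 hmem j
    rw [abs_le]
    constructor <;> linarith [hj.1, hj.2]
  choose g hg using hlim
  have hφ4 : ∀ j, φ j ≤ 4 * D * ((j + 1) / 2 ^ j) := fun j => by
    have : ((j : ℝ) + 2) / 2 ^ j ≤ (2 * (j + 1)) / 2 ^ j := by
      gcongr
      have : (0 : ℝ) ≤ j := Nat.cast_nonneg j
      linarith
    have := mul_le_mul_of_nonneg_left this (show 0 ≤ 2 * D by positivity)
    exact this.trans (le_of_eq (by ring))
  refine ⟨g, fun j t => (hg t j).trans (hφ4 j), fun j t u => ?_⟩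
  have hp : (0 : ℝ) < 2 ^ j := by positivity
  have e1 := (hg t j).trans (hφ4 j)
  have e2 := (hg u j).trans (hφ4 j)
  have e3 := abs_sub_le_of_abs_fwdDelta_le (h1 j) ⌊2 ^ j * t⌋ ⌊2 ^ j * u⌋
  have e4 : |((⌊2 ^ j * t⌋ : ℤ) : ℝ) - ⌊2 ^ j * u⌋| ≤ 2 ^ j * |t - u| + 1 := by
    have a1 := Int.floor_le (2 ^ j * t)
    have a2 := Int.lt_floor_add_one (2 ^ j * t)
    have a3 := Int.floor_le (2 ^ j * u)
    have a4 := Int.lt_floor_add_one (2 ^ j * u)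
    have a5 : |2 ^ j * t - 2 ^ j * u| = 2 ^ j * |t - u| := by
      rw [← mul_sub, abs_mul, abs_of_pos hp]
    rw [← a5]
    have a6 := le_abs_self (2 ^ j * t - 2 ^ j * u)
    have a7 := neg_abs_le (2 ^ j * t - 2 ^ j * u)
    rw [abs_le]
    constructor <;> linarith
  have e5 : |y j ⌊2 ^ j * t⌋ - y j ⌊2 ^ j * u⌋|
      ≤ D * (j + 1) * (|t - u| + 1 / 2 ^ j) := by
    refine e3.trans ((mul_le_mul_of_nonneg_right e4 (by positivity)).trans (le_of_eq ?_))
    field_simp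
  have e6 : D * ((j : ℝ) + 1) * (|t - u| + 9 / 2 ^ j) = D * (j + 1) * (|t - u| + 1 / 2 ^ j)
      + 4 * D * ((j + 1) / 2 ^ j) + 4 * D * ((j + 1) / 2 ^ j) := by ring
  rw [e6]
  rw [abs_le] at e1 e2 e5 ⊢
  constructor <;> linarith

/-- Limits of divided differences are derivatives: if the data `y` converge to `f` and the
divided differences of `y` converge uniformly to a continuous `g`, then `f' = g`. -/
theorem hasDerivAt_of_tendsto_grid {f g : ℝ → ℝ} {y z : ℕ → ℤ → ℝ} {e : ℕ → ℝ}
    (hyz : ∀ j i, fwdDelta (y j) i = z j i / 2 ^ j)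
    (hf : ∀ t, Tendsto (fun j => y j ⌊2 ^ j * t⌋) atTop (𝓝 (f t)))
    (hz : ∀ j t, |z j ⌊2 ^ j * t⌋ - g t| ≤ e j) (he : Tendsto e atTop (𝓝 0))
    (hg : Continuous g) (u : ℝ) : HasDerivAt f (g u) u := by
  have key : ∀ a b ε : ℝ, 0 < ε → (∀ ξ, a < ξ → ξ < b → |g ξ - g u| ≤ ε) →
      ∀ t t', a < t → t ≤ t' → t' < b → |f t' - f t - (t' - t) * g u| ≤ (t' - t) * (2 * ε) := by
    intro a b ε hε hab t t' hat htt hb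
    have hl : Tendsto (fun j : ℕ => |y j ⌊2 ^ j * t'⌋ - y j ⌊2 ^ j * t⌋
        - ((⌊2 ^ j * t'⌋ : ℝ) / 2 ^ j - (⌊2 ^ j * t⌋ : ℝ) / 2 ^ j) * g u|) atTop
        (𝓝 |f t' - f t - (t' - t) * g u|) :=
      (((hf t').sub (hf t)).sub (((tendsto_floor_two_pow_mul_div t').sub
        (tendsto_floor_two_pow_mul_div t)).mul_const _)).abs
    have hr : Tendsto (fun j : ℕ => ((⌊2 ^ j * t'⌋ : ℝ) / 2 ^ j - (⌊2 ^ j * t⌋ : ℝ) / 2 ^ j)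
        * (2 * ε)) atTop (𝓝 ((t' - t) * (2 * ε))) :=
      ((tendsto_floor_two_pow_mul_div t').sub (tendsto_floor_two_pow_mul_div t)).mul_const _
    refine le_of_tendsto_of_tendsto hl hr ?_
    filter_upwards [he.eventually (ge_mem_nhds hε),
      (tendsto_floor_two_pow_mul_div t).eventually (lt_mem_nhds hat)] with j hj1 hj2
    have hp : (0 : ℝ) < 2 ^ j := by positivity
    have hfl : ⌊2 ^ j * t⌋ ≤ ⌊2 ^ j * t'⌋ := Int.floor_le_floor (by gcongr)
    have hup : (⌊2 ^ j * t'⌋ : ℝ) / 2 ^ j < b := by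
      refine lt_of_le_of_lt ?_ hb
      rw [div_le_iff₀ hp, mul_comm]; exact Int.floor_le _
    have hind : ∀ n : ℕ, ((⌊2 ^ j * t⌋ + n : ℤ) : ℝ) / 2 ^ j < b →
        |y j (⌊2 ^ j * t⌋ + n) - y j ⌊2 ^ j * t⌋ - (n / 2 ^ j) * g u| ≤ (n / 2 ^ j) * (2 * ε) := by
      intro n
      induction n with
      | zero => intro _; simp
      | succ n ih =>
        intro hn
        have hlt : ((⌊2 ^ j * t⌋ + n : ℤ) : ℝ) / 2 ^ j < b := by
          refine lt_of_le_of_lt ?_ hn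
          gcongr
          simp
        have hgt : a < ((⌊2 ^ j * t⌋ + n : ℤ) : ℝ) / 2 ^ j := by
          refine hj2.trans_le ?_
          gcongr
          simp
        have i1 := ih hlt
        have i2 := hab _ hgt hlt
        have i3 := hz j (((⌊2 ^ j * t⌋ + n : ℤ) : ℝ) / 2 ^ j)
        rw [mul_div_cancel₀ _ hp.ne', Int.floor_intCast] at i3
        have i4 := hyz j (⌊2 ^ j * t⌋ + n)
        rw [fwdDelta] at i4
        have i5 : |z j (⌊2 ^ j * t⌋ + n) - g u| ≤ 2 * ε := by
          rw [abs_le] at *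
          constructor <;> linarith
        have i6 : |(z j (⌊2 ^ j * t⌋ + n) - g u) / 2 ^ j| ≤ 2 * ε / 2 ^ j := by
          rw [abs_div, abs_of_pos hp]; gcongr
        have i7 : y j (⌊2 ^ j * t⌋ + (n + 1 : ℕ)) - y j ⌊2 ^ j * t⌋ - ((n + 1 : ℕ) / 2 ^ j) * g u
            = (y j (⌊2 ^ j * t⌋ + n) - y j ⌊2 ^ j * t⌋ - (n / 2 ^ j) * g u)
              + (z j (⌊2 ^ j * t⌋ + n) - g u) / 2 ^ j := by
          push_cast
          rw [← add_assoc]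
          linear_combination i4
        rw [i7]
        refine (abs_add_le _ _).trans ((add_le_add i1 i6).trans (le_of_eq ?_))
        push_cast; ring
    obtain ⟨n, hn⟩ := Int.le.dest hfl
    have := hind n (by rw [hn]; exact hup)
    rw [hn] at this
    have hn' : ((⌊2 ^ j * t'⌋ : ℤ) : ℝ) / 2 ^ j - (⌊2 ^ j * t⌋ : ℝ) / 2 ^ j = n / 2 ^ j := by
      rw [← hn]; push_cast; ring
    rw [hn']
    exact this
  rw [hasDerivAt_iff_isLittleO, Asymptotics.isLittleO_iff]
  intro c hc
  obtain ⟨δ, hδ, hgδ⟩ := Metric.continuous_iff.1 hg u (c / 2) (by positivity)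
  have hab : ∀ ξ, u - δ < ξ → ξ < u + δ → |g ξ - g u| ≤ c / 2 := fun ξ h h' =>
    (hgδ ξ (by rw [Real.dist_eq, abs_lt]; constructor <;> linarith)).le
  filter_upwards [Metric.ball_mem_nhds u hδ] with t ht
  rw [Metric.mem_ball, Real.dist_eq, abs_lt] at ht
  rw [Real.norm_eq_abs, Real.norm_eq_abs, smul_eq_mul]
  rcases le_total u t with h | h
  · have := key (u - δ) (u + δ) (c / 2) (by positivity) hab u t (by linarith) h (by linarith)
    rw [abs_of_nonneg (sub_nonneg.2 h)]
    linarith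
  · have := key (u - δ) (u + δ) (c / 2) (by positivity) hab t u (by linarith) h (by linarith)
    rw [abs_of_nonpos (sub_nonpos.2 h),
      show f t - f u - (t - u) * g u = -(f u - f t - (u - t) * g u) by ring, abs_neg]
    linarith

/-! ### Bounded Hölder functions -/

/-- Bounded functions that are globally Hölder continuous of exponent `α`; a single constant
serves for both bounds. -/
def IsBddHolder {E : Type*} [NormedAddCommGroup E] (α : ℝ) (f : ℝ → E) : Prop :=
  ∃ B : ℝ, 0 ≤ B ∧ (∀ t, ‖f t‖ ≤ B) ∧ ∀ t u, ‖f t - f u‖ ≤ B * |t - u| ^ α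

namespace IsBddHolder

variable {E : Type*} [NormedAddCommGroup E] {α : ℝ}

theorem add {f g : ℝ → E} (hf : IsBddHolder α f) (hg : IsBddHolder α g) :
    IsBddHolder α fun t => f t + g t := by
  obtain ⟨A, hA, f1, f2⟩ := hf
  obtain ⟨B, hB, g1, g2⟩ := hg
  refine ⟨A + B, by positivity, fun t => (norm_add_le _ _).trans (add_le_add (f1 t) (g1 t)),
    fun t u => ?_⟩
  rw [add_sub_add_comm, add_mul]
  exact (norm_add_le _ _).trans (add_le_add (f2 t u) (g2 t u))

theorem smul [NormedSpace ℝ E] {f : ℝ → ℝ} {g : ℝ → E} (hf : IsBddHolder α f)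
    (hg : IsBddHolder α g) : IsBddHolder α fun t => f t • g t := by
  obtain ⟨A, hA, f1, f2⟩ := hf
  obtain ⟨B, hB, g1, g2⟩ := hg
  refine ⟨2 * (A * B), by positivity, fun t => ?_, fun t u => ?_⟩
  · rw [norm_smul]
    calc _ ≤ A * B := by gcongr; exacts [f1 t, g1 t]
      _ ≤ _ := by nlinarith [mul_nonneg hA hB]
  · have h : f t • g t - f u • g u = f t • (g t - g u) + (f t - f u) • g u := by
      rw [smul_sub, sub_smul]; abel
    rw [h]
    refine (norm_add_le _ _).trans ?_
    rw [norm_smul, norm_smul]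
    calc _ ≤ A * (B * |t - u| ^ α) + (A * |t - u| ^ α) * B := by
          gcongr; exacts [f1 t, g2 t u, f2 t u, g1 u]
      _ = _ := by ring

theorem const_mul {f : ℝ → ℝ} (hf : IsBddHolder α f) (c : ℝ) : IsBddHolder α fun t => c * f t := by
  obtain ⟨A, hA, f1, f2⟩ := hf
  refine ⟨|c| * A, by positivity, fun t => ?_, fun t u => ?_⟩
  · rw [norm_mul, Real.norm_eq_abs c]; gcongr; exact f1 t
  · rw [← mul_sub, norm_mul, Real.norm_eq_abs c, mul_assoc]; gcongr; exact f2 t u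

theorem of_lipschitz (hα₀ : 0 ≤ α) (hα₁ : α ≤ 1) {f : ℝ → E} {B C : ℝ} (hb : ∀ t, ‖f t‖ ≤ B)
    (hl : ∀ t u, ‖f t - f u‖ ≤ C * |t - u|) : IsBddHolder α f := by
  have hB : 0 ≤ B := (norm_nonneg _).trans (hb 0)
  have hC : 0 ≤ C := by simpa using (norm_nonneg _).trans (hl 1 0)
  refine ⟨2 * B + C, by positivity, fun t => (hb t).trans (by linarith), fun t u => ?_⟩
  rcases le_total |t - u| 1 with h | h
  · rcases (abs_nonneg (t - u)).eq_or_lt with h0 | h0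
    · have := hl t u
      rw [← h0, mul_zero] at this
      exact this.trans (by positivity)
    · have h1 : |t - u| ≤ |t - u| ^ α := by
        simpa using Real.rpow_le_rpow_of_exponent_ge h0 h hα₁
      calc _ ≤ C * |t - u| := hl t u
        _ ≤ C * |t - u| ^ α := by gcongr
        _ ≤ _ := by gcongr; linarith
  · have h1 : 1 ≤ |t - u| ^ α := Real.one_le_rpow h hα₀
    have h2 : ‖f t - f u‖ ≤ B + B := (norm_sub_le _ _).trans (add_le_add (hb t) (hb u))
    nlinarith

theorem of_modulus (hα₀ : 0 < α) (hα₁ : α < 1) {f : ℝ → ℝ} {B D : ℝ} (hb : ∀ t, |f t| ≤ B)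
    (hD : 0 ≤ D) (hm : ∀ (j : ℕ) t u, |f t - f u| ≤ D * (j + 1) * (|t - u| + 9 / 2 ^ j)) :
    IsBddHolder α f := by
  have hB : 0 ≤ B := (abs_nonneg _).trans (hb 0)
  obtain ⟨M, hM⟩ : ∃ M : ℝ, ∀ j : ℕ, (j : ℝ) * ((1 / 2 : ℝ) ^ (1 - α)) ^ j ≤ M := by
    have h := tendsto_self_mul_const_pow_of_lt_one (r := (1 / 2 : ℝ) ^ (1 - α)) (by positivity)
      (Real.rpow_lt_one (by norm_num) (by norm_num) (by linarith))
    obtain ⟨M, hM⟩ := h.bddAbove_range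
    exact ⟨M, fun j => hM ⟨j, rfl⟩⟩
  have hM0 : 0 ≤ M := by simpa using hM 0
  refine ⟨2 * B + 20 * D * M, by positivity, fun t => (hb t).trans ?_, fun t u => ?_⟩
  · have : 0 ≤ 20 * D * M := by positivity
    linarith
  rw [Real.norm_eq_abs]
  rcases le_or_gt |t - u| 1 with h | h
  · rcases (abs_nonneg (t - u)).eq_or_lt with h0 | h0
    · have : t = u := sub_eq_zero.1 (abs_eq_zero.1 h0.symm)
      rw [this, sub_self, abs_zero]; positivity
    -- the optimal level is the one whose mesh size is comparable to `|t - u|`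
    obtain ⟨j, hj1, hj2⟩ := exists_nat_pow_near_of_lt_one h0 h
      (show (0 : ℝ) < 1 / 2 by norm_num) (by norm_num)
    have h1 := hm j t u
    have h2 : |t - u| + 9 / 2 ^ j ≤ 20 * (1 / 2) ^ (j + 1) := by
      rw [one_div_pow] at hj2 ⊢
      rw [pow_succ]
      have : 20 * (1 / ((2 : ℝ) ^ j * 2)) = 1 / 2 ^ j + 9 / 2 ^ j := by field_simp; norm_num
      linarith
    have h3 : ((1 / 2 : ℝ) ^ (j + 1)) ^ α ≤ |t - u| ^ α :=
      Real.rpow_le_rpow (by positivity) hj1.le hα₀.le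
    have h4 : (1 / 2 : ℝ) ^ (j + 1)
        = ((1 / 2 : ℝ) ^ (1 - α)) ^ (j + 1) * ((1 / 2 : ℝ) ^ (j + 1)) ^ α := by
      rw [← Real.rpow_natCast ((1 / 2 : ℝ) ^ (1 - α)), ← Real.rpow_mul (by norm_num),
        ← Real.rpow_natCast (1 / 2 : ℝ), ← Real.rpow_mul (by norm_num),
        ← Real.rpow_add (by norm_num)]
      congr 1; ring
    have h5 := hM (j + 1)
    push_cast at h5
    calc |f t - f u| ≤ D * (j + 1) * (20 * (1 / 2) ^ (j + 1)) := h1.trans (by gcongr)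
      _ = D * (j + 1) * (20 * (((1 / 2 : ℝ) ^ (1 - α)) ^ (j + 1)
            * ((1 / 2 : ℝ) ^ (j + 1)) ^ α)) := by rw [← h4]
      _ = 20 * D * ((j + 1) * ((1 / 2 : ℝ) ^ (1 - α)) ^ (j + 1)) * ((1 / 2 : ℝ) ^ (j + 1)) ^ α := by
        ring
      _ ≤ 20 * D * M * |t - u| ^ α := by gcongr
      _ ≤ _ := by gcongr; linarith
  · have h1 : 1 ≤ |t - u| ^ α := Real.one_le_rpow h.le hα₀.le
    have h2 : |f t - f u| ≤ B + B := (abs_sub _ _).trans (add_le_add (hb t) (hb u))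
    have h3 : 0 ≤ 20 * D * M * |t - u| ^ α := by positivity
    nlinarith

theorem exists_holderWith {α : NNReal} {f : ℝ → E} (hf : IsBddHolder (α : ℝ) f) :
    ∃ C : NNReal, HolderWith C α f := by
  obtain ⟨B, hB, -, h⟩ := hf
  refine ⟨B.toNNReal, fun t u => ?_⟩
  rw [edist_dist, edist_dist, dist_eq_norm, Real.dist_eq,
    ENNReal.ofReal_rpow_of_nonneg (abs_nonneg _) α.coe_nonneg]
  refine (ENNReal.ofReal_le_ofReal (h t u)).trans (le_of_eq ?_)
  rw [ENNReal.ofReal_mul hB]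
  rfl

end IsBddHolder

theorem isHolderSmooth_three {E : Type*} [NormedAddCommGroup E] [NormedSpace ℝ E] {α : NNReal}
    (hα : 0 < α) {f f₁ f₂ f₃ : ℝ → E} (h₀ : ∀ t, HasDerivAt f (f₁ t) t)
    (h₁ : ∀ t, HasDerivAt f₁ (f₂ t) t) (h₂ : ∀ t, HasDerivAt f₂ (f₃ t) t)
    (h₃ : IsBddHolder (α : ℝ) f₃) : IsHolderSmooth 3 α f := by
  have e₀ : deriv f = f₁ := funext fun t => (h₀ t).deriv
  have e₁ : deriv f₁ = f₂ := funext fun t => (h₁ t).deriv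
  have e₂ : deriv f₂ = f₃ := funext fun t => (h₂ t).deriv
  obtain ⟨C, hC⟩ := h₃.exists_holderWith
  have c₂ : ContDiff ℝ 1 f₂ := contDiff_one_iff_deriv.2
    ⟨fun t => (h₂ t).differentiableAt, e₂ ▸ hC.continuous hα⟩
  have c₁ : ContDiff ℝ (1 + 1) f₁ := contDiff_succ_iff_deriv.2
    ⟨fun t => (h₁ t).differentiableAt, by simp, e₁ ▸ c₂⟩
  have c₀ : ContDiff ℝ (1 + 1 + 1) f := contDiff_succ_iff_deriv.2
    ⟨fun t => (h₀ t).differentiableAt, by simp, e₀ ▸ c₁⟩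
  refine ⟨?_, C, ?_⟩
  · convert c₀ using 1
    norm_num
  · rw [iteratedDeriv_succ', iteratedDeriv_succ', iteratedDeriv_one, e₀, e₁, e₂]
    exact hC

/-! ### Smoothness of the limit parametrization -/

/-- A sequence of data with the rates of a normal transform has scaled differences
`2 ^ (k j) Δ^k s^j`, `k ≤ 3`, that converge uniformly. -/
theorem exists_limit_scaled_fwdDelta {s : ℕ → ℤ → ℝ} {p : ℕ} (hp : 4 ≤ p) {C : ℝ} (hC : 0 ≤ C)
    (hoff : ∀ j K, |offset p s (j + 1) K| ≤ C * (1 / 16 ^ j))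
    (hdiff : ∀ k, 1 ≤ k → k ≤ 4 → ∀ j K, |fwdDelta^[k] (s j) K| ≤ C * ((j + 1) / 2 ^ (k * j)))
    {k : ℕ} (hk : k ≤ 3) :
    ∃ D, 0 ≤ D ∧ ∃ g : ℝ → ℝ,
      (∀ j t, |2 ^ (k * j) * fwdDelta^[k] (s j) ⌊2 ^ j * t⌋ - g t| ≤ 4 * D * ((j + 1) / 2 ^ j)) ∧
      ∀ (j : ℕ) t u, |g t - g u| ≤ D * (j + 1) * (|t - u| + 9 / 2 ^ j) := by
  have h1 : ∀ j K, |fwdDelta (fun i => 2 ^ (k * j) * fwdDelta^[k] (s j) i) K|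
      ≤ C * ((j + 1) / 2 ^ j) := by
    intro j K
    have e : fwdDelta (fun i => 2 ^ (k * j) * fwdDelta^[k] (s j) i) K
        = 2 ^ (k * j) * fwdDelta^[k + 1] (s j) K := by
      rw [Function.iterate_succ_apply', fwdDelta, fwdDelta]; ring
    have h := hdiff (k + 1) (by omega) (by omega) j K
    rw [e, abs_mul, abs_of_pos (by positivity : (0 : ℝ) < 2 ^ (k * j))]
    calc _ ≤ 2 ^ (k * j) * (C * ((j + 1) / 2 ^ ((k + 1) * j))) := by gcongr
      _ = _ := by rw [add_mul, pow_add, one_mul]; field_simp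
  obtain ⟨r, hr⟩ := Nat.exists_eq_add_of_le' (show k ≤ p by omega)
  have h2 : ∀ j K, |2 ^ (k * (j + 1)) * fwdDelta^[k] (s (j + 1)) K
      - 2 ^ (k * j) * fwdDelta^[k] (s j) (K / 2)| ≤ (r + 64) * C * ((j + 1) / 2 ^ j) := by
    intro j K
    have hs : s (j + 1) = bsplineSub (r + k) (s j) + offset p s (j + 1) := by
      funext K; simp [offset, hr]
    have e1 : (2 : ℝ) ^ (k * (j + 1)) = 2 ^ (k * j) * 2 ^ k := by ring
    have e2 : 2 ^ (k * (j + 1)) * fwdDelta^[k] (s (j + 1)) K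
        = bsplineSub r (fun i => 2 ^ (k * j) * fwdDelta^[k] (s j) i) K
          + 2 ^ (k * (j + 1)) * fwdDelta^[k] (offset p s (j + 1)) K := by
      rw [bsplineSub_const_mul, hs, iterate_fwdDelta_add, iterate_fwdDelta_bsplineSub]
      simp only [Pi.add_apply, Pi.smul_apply, smul_eq_mul]
      rw [e1, one_div_pow]; field_simp
    have h3 := norm_bsplineSub_sub_le r (fun i => 2 ^ (k * j) * fwdDelta^[k] (s j) i) (h1 j) K
    have h4 : |2 ^ (k * (j + 1)) * fwdDelta^[k] (offset p s (j + 1)) K|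
        ≤ 64 * C * ((j + 1) / 2 ^ j) := by
      rw [abs_mul, abs_of_pos (by positivity : (0 : ℝ) < 2 ^ (k * (j + 1)))]
      have a1 : (2 : ℝ) ^ (k * (j + 1)) ≤ 2 ^ (3 * (j + 1)) :=
        pow_le_pow_right₀ (by norm_num) (by gcongr)
      have a2 : (2 : ℝ) ^ k ≤ 2 ^ 3 := pow_le_pow_right₀ (by norm_num) hk
      have a3 : (16 : ℝ) ^ j = 8 ^ j * 2 ^ j := by rw [← mul_pow]; norm_num
      have a4 : (2 : ℝ) ^ (3 * (j + 1)) = 8 * 8 ^ j := by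
        rw [pow_mul, pow_succ]; norm_num; ring
      calc _ ≤ 2 ^ (3 * (j + 1)) * (2 ^ 3 * (C * (1 / 16 ^ j))) := by
            gcongr
            exact (abs_iterate_fwdDelta_le (hoff j) k K).trans (by gcongr)
        _ = 64 * C * (1 / 2 ^ j) := by rw [a3, a4]; field_simp; ring
        _ ≤ _ := by
          gcongr
          have : (0 : ℝ) ≤ j := Nat.cast_nonneg j
          linarith
    rw [e2, add_sub_right_comm]
    refine (abs_add_le _ _).trans ((add_le_add h3 h4).trans (le_of_eq ?_))
    ring
  obtain ⟨g, hg1, hg2⟩ := exists_limit_of_refinement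
    (y := fun j i => 2 ^ (k * j) * fwdDelta^[k] (s j) i) (D := (r + 64) * C) (by positivity)
    (fun j K => (h1 j K).trans (by
      gcongr
      have : (0 : ℝ) ≤ r := Nat.cast_nonneg r
      nlinarith)) h2
  exact ⟨_, by positivity, g, hg1, hg2⟩

/-- Under the rates of a normal transform, the limit has three derivatives, all of them bounded
and Hölder continuous of every exponent below one. -/
theorem exists_bddHolder_derivs {s : ℕ → ℤ → ℝ} {σ : ℝ → ℝ} {p : ℕ} (hp : 4 ≤ p) {C : ℝ}
    (hC : 0 ≤ C) (hoff : ∀ j K, |offset p s (j + 1) K| ≤ C * (1 / 16 ^ j))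
    (hdiff : ∀ k, 1 ≤ k → k ≤ 4 → ∀ j K, |fwdDelta^[k] (s j) K| ≤ C * ((j + 1) / 2 ^ (k * j)))
    (hσ : ∀ t, Tendsto (fun j => s j ⌊2 ^ j * t⌋) atTop (𝓝 (σ t))) :
    ∃ g₁ g₂ g₃ : ℝ → ℝ, (∀ t, HasDerivAt σ (g₁ t) t) ∧ (∀ t, HasDerivAt g₁ (g₂ t) t) ∧
      (∀ t, HasDerivAt g₂ (g₃ t) t) ∧ ∀ α : ℝ, 0 < α → α < 1 →
        IsBddHolder α g₁ ∧ IsBddHolder α g₂ ∧ IsBddHolder α g₃ := by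
  have hlim := fun k (hk : k ≤ 3) => exists_limit_scaled_fwdDelta hp hC hoff hdiff hk
  have hzero : ∀ D : ℝ, Tendsto (fun j : ℕ => 4 * D * (((j : ℝ) + 1) / 2 ^ j)) atTop (𝓝 0) :=
    fun D => by simpa using tendsto_succ_div_two_pow.const_mul (4 * D)
  -- for `k ≥ 1` the level zero differences are bounded, and hence so are the limits
  have hbdd : ∀ k, 1 ≤ k → k ≤ 3 → ∀ (D : ℝ) (g : ℝ → ℝ), 0 ≤ D →
      (∀ j t, |2 ^ (k * j) * fwdDelta^[k] (s j) ⌊2 ^ j * t⌋ - g t|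
        ≤ 4 * D * (((j : ℕ) + 1) / 2 ^ j)) →
      (∀ (j : ℕ) t u, |g t - g u| ≤ D * (j + 1) * (|t - u| + 9 / 2 ^ j)) →
      ∀ α : ℝ, 0 < α → α < 1 → IsBddHolder α g := by
    intro k hk1 hk3 D g hD hg1 hg2 α hα0 hα1
    refine IsBddHolder.of_modulus (B := C + 4 * D) hα0 hα1 (fun t => ?_) hD hg2
    have e1 := hg1 0 t
    have e2 := hdiff k hk1 (by omega) 0 ⌊2 ^ 0 * t⌋
    simp only [mul_zero, pow_zero, one_mul, Nat.cast_zero, zero_add, div_one, mul_one] at e1 e2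
    rw [abs_le] at *
    constructor <;> linarith
  have hscale : ∀ k j i, fwdDelta (fun i => 2 ^ (k * j) * fwdDelta^[k] (s j) i) i
      = 2 ^ ((k + 1) * j) * fwdDelta^[k + 1] (s j) i / 2 ^ j := by
    intro k j i
    rw [Function.iterate_succ_apply', fwdDelta, fwdDelta, add_mul, pow_add, one_mul]
    field_simp
  have htend : ∀ k, ∀ (D : ℝ) (g : ℝ → ℝ),
      (∀ j t, |2 ^ (k * j) * fwdDelta^[k] (s j) ⌊2 ^ j * t⌋ - g t|
        ≤ 4 * D * (((j : ℕ) + 1) / 2 ^ j)) →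
      ∀ t, Tendsto (fun j : ℕ => 2 ^ (k * j) * fwdDelta^[k] (s j) ⌊2 ^ j * t⌋) atTop (𝓝 (g t)) := by
    intro k D g hg t
    rw [tendsto_iff_dist_tendsto_zero]
    exact squeeze_zero (fun _ => dist_nonneg) (fun j => by rw [Real.dist_eq]; exact hg j t)
      (hzero D)
  obtain ⟨D₁, hD₁, g₁, a₁, b₁⟩ := hlim 1 (by norm_num)
  obtain ⟨D₂, hD₂, g₂, a₂, b₂⟩ := hlim 2 (by norm_num)
  obtain ⟨D₃, hD₃, g₃, a₃, b₃⟩ := hlim 3 (by norm_num)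
  have H₁ := hbdd 1 le_rfl (by norm_num) D₁ g₁ hD₁ a₁ b₁
  have H₂ := hbdd 2 (by norm_num) (by norm_num) D₂ g₂ hD₂ a₂ b₂
  have H₃ := hbdd 3 (by norm_num) (by norm_num) D₃ g₃ hD₃ a₃ b₃
  have hcont : ∀ g : ℝ → ℝ, (∀ α : ℝ, 0 < α → α < 1 → IsBddHolder α g) → Continuous g := by
    intro g hg
    have h : IsBddHolder ((1 / 2 : NNReal) : ℝ) g := hg _ (by norm_num) (by norm_num)
    obtain ⟨C, hC⟩ := h.exists_holderWith
    exact hC.continuous (by norm_num)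
  refine ⟨g₁, g₂, g₃, ?_, ?_, ?_, fun α h0 h1 => ⟨H₁ α h0 h1, H₂ α h0 h1, H₃ α h0 h1⟩⟩
  · exact hasDerivAt_of_tendsto_grid (y := s)
      (z := fun j i => 2 ^ (1 * j) * fwdDelta^[1] (s j) i)
      (fun j i => by simp) hσ a₁ (hzero D₁) (hcont g₁ H₁)
  · exact hasDerivAt_of_tendsto_grid (hscale 1) (htend 1 D₁ g₁ a₁) a₂ (hzero D₂) (hcont g₂ H₂)
  · exact hasDerivAt_of_tendsto_grid (hscale 2) (htend 2 D₂ g₂ a₂) a₃ (hzero D₃) (hcont g₃ H₃)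

theorem norm_gridInterp_sub_le {E : Type*} [NormedAddCommGroup E] [NormedSpace ℝ E] (j : ℕ)
    (x : ℤ → E) (t : ℝ) (a : E) :
    ‖gridInterp j x t - a‖ ≤ ‖x ⌊2 ^ j * t⌋ - a‖ + ‖x (⌊2 ^ j * t⌋ + 1) - a‖ := by
  have h0 := Int.fract_nonneg (2 ^ j * t)
  have h1 := (Int.fract_lt_one (2 ^ j * t)).le
  have e : gridInterp j x t - a = (1 - Int.fract (2 ^ j * t)) • (x ⌊2 ^ j * t⌋ - a)
      + Int.fract (2 ^ j * t) • (x (⌊2 ^ j * t⌋ + 1) - a) := by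
    rw [gridInterp]; module
  rw [e]
  refine (norm_add_le _ _).trans (add_le_add ?_ ?_) <;> rw [norm_smul, Real.norm_eq_abs]
  · rw [abs_of_nonneg (by linarith)]
    exact mul_le_of_le_one_left (norm_nonneg _) (by linarith)
  · rw [abs_of_nonneg h0]
    exact mul_le_of_le_one_left (norm_nonneg _) h1

theorem isHolderSmooth_comp {v v₁ v₂ v₃ : ℝ → Plane} {B : ℝ} (hB : BoundedDerivs v v₁ v₂ v₃ B)
    {α : NNReal} (hα₀ : 0 < α) (hα₁ : α < 1) {σ g₁ g₂ g₃ : ℝ → ℝ}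
    (h₁ : ∀ t, HasDerivAt σ (g₁ t) t) (h₂ : ∀ t, HasDerivAt g₁ (g₂ t) t)
    (h₃ : ∀ t, HasDerivAt g₂ (g₃ t) t) (H₁ : IsBddHolder (α : ℝ) g₁)
    (H₂ : IsBddHolder (α : ℝ) g₂) (H₃ : IsBddHolder (α : ℝ) g₃) :
    IsHolderSmooth 3 α fun t => v (σ t) := by
  have hlip : ∀ {f f' : ℝ → ℝ} {A : ℝ}, (∀ t, HasDerivAt f (f' t) t) → (∀ t, ‖f' t‖ ≤ A) →
      ∀ t u, |f t - f u| ≤ A * |t - u| := fun hf hA t u =>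
    convex_univ.norm_image_sub_le_of_norm_hasDerivWithin_le (fun x _ => (hf x).hasDerivWithinAt)
      (fun x _ => hA x) (Set.mem_univ u) (Set.mem_univ t)
  have hlip' : ∀ {f f' : ℝ → Plane}, (∀ t, HasDerivAt f (f' t) t) → (∀ t, ‖f' t‖ ≤ B) →
      ∀ t u, ‖f t - f u‖ ≤ B * |t - u| := fun hf hA t u =>
    convex_univ.norm_image_sub_le_of_norm_hasDerivWithin_le (fun x _ => (hf x).hasDerivWithinAt)
      (fun x _ => hA x) (Set.mem_univ u) (Set.mem_univ t)
  obtain ⟨A, hA, hgA, -⟩ := id H₁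
  have hcomp : ∀ f : ℝ → Plane, (∀ t, ‖f t‖ ≤ B) → (∀ t u, ‖f t - f u‖ ≤ B * |t - u|) →
      IsBddHolder (α : ℝ) fun t => f (σ t) := fun f hf hl => by
    refine IsBddHolder.of_lipschitz (C := B * A) α.coe_nonneg (by exact_mod_cast hα₁.le)
      (fun t => hf _) fun t u => (hl _ _).trans ?_
    rw [mul_assoc]
    exact mul_le_mul_of_nonneg_left (hlip h₁ hgA t u) hB.nonneg
  have K₁ := hcomp v₁ (fun t => (hB.norm_one t).trans_le hB.one_le)
    (hlip' hB.hasDerivAt₁ hB.norm_two)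
  have K₂ := hcomp v₂ hB.norm_two (hlip' hB.hasDerivAt₂ hB.norm_three)
  have K₃ := hcomp v₃ hB.norm_three fun t u => hB.lipschitz u t
  have c₁ : ∀ t, HasDerivAt (fun t => v₁ (σ t)) (g₁ t • v₂ (σ t)) t := fun t =>
    (hB.hasDerivAt₁ (σ t)).scomp t (h₁ t)
  have c₂ : ∀ t, HasDerivAt (fun t => v₂ (σ t)) (g₁ t • v₃ (σ t)) t := fun t =>
    (hB.hasDerivAt₂ (σ t)).scomp t (h₁ t)
  refine isHolderSmooth_three hα₀
    (f₁ := fun t => g₁ t • v₁ (σ t))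
    (f₂ := fun t => g₂ t • v₁ (σ t) + (g₁ t • g₁ t) • v₂ (σ t))
    (f₃ := fun t => (g₃ t • v₁ (σ t) + (3 * (g₁ t • g₂ t)) • v₂ (σ t))
      + (g₁ t • g₁ t • g₁ t) • v₃ (σ t))
    (fun t => (hB.hasDerivAt₀ (σ t)).scomp t (h₁ t)) (fun t => ?_) (fun t => ?_)
    (((H₃.smul K₁).add (((H₁.smul H₂).const_mul 3).smul K₂)).add
      ((H₁.smul (H₁.smul H₁)).smul K₃))
  · convert (h₂ t).fun_smul (c₁ t) using 1
    module
  · convert ((h₃ t).fun_smul (c₁ t)).fun_add (((h₂ t).fun_smul (h₂ t)).fun_smul (c₂ t)) using 1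
    simp only [smul_eq_mul]
    module

theorem theorem3p4 (p : ℕ) (hp : 4 ≤ p)
    (L : ℝ) (v : ℝ → Plane) (hv : IsClosedArcLengthCurve L v) (hv4 : ContDiff ℝ 4 v)
    (N : ℕ) (hN : 0 < N) (s d : ℕ → ℤ → ℝ)
    (hwp : IsWellPosedNormalMT v L N p (p - 2) s d)
    (σ : ℝ → ℝ) (hconv : ConvergesTo s σ) :
    (∃ C : ℝ, ∀ j : ℕ, 1 ≤ j → ∀ K : ℤ, |offset p s j K| ≤ C / 2 ^ (4 * j)) ∧
    (∀ t : ℝ, Filter.Tendsto (fun j => gridInterp j (fun i => v (s j i)) t)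
      Filter.atTop (nhds (v (σ t)))) ∧
    (∀ α : NNReal, 0 < α → α < 1 →
      IsHolderSmooth 3 α σ ∧ IsHolderSmooth 3 α (fun t => v (σ t))) := by
  obtain ⟨q, rfl⟩ := Nat.exists_eq_add_of_le' (show 2 ≤ p by omega)
  rw [Nat.add_sub_cancel] at hwp
  obtain ⟨B, hB⟩ := hv.exists_boundedDerivs hv4
  obtain ⟨C, hC, hoff, hdiff⟩ := hwp.exists_rates hv hv4 hN (by omega) hconv
  -- the grid values, not only their interpolants, converge to `σ`
  have hmesh : ∀ t : ℝ, Tendsto (fun j => fwdDelta (s j) ⌊2 ^ j * t⌋) atTop (𝓝 0) := fun t => by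
    refine squeeze_zero_norm (fun j => hdiff 1 le_rfl (by norm_num) j ⌊2 ^ j * t⌋) ?_
    simpa using tendsto_succ_div_two_pow.const_mul C
  have hfloor : ∀ t : ℝ, Tendsto (fun j => s j ⌊2 ^ j * t⌋) atTop (𝓝 (σ t)) := fun t => by
    have h1 : Tendsto (fun j => Int.fract (2 ^ j * t) * fwdDelta (s j) ⌊2 ^ j * t⌋) atTop
        (𝓝 0) := by
      refine squeeze_zero_norm (fun j => ?_) (by simpa using (hmesh t).norm)
      rw [norm_mul, Real.norm_of_nonneg (Int.fract_nonneg _)]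
      exact mul_le_of_le_one_left (norm_nonneg _) (Int.fract_lt_one _).le
    have h2 := (hconv.tendsto t).sub h1
    rw [sub_zero] at h2
    refine h2.congr fun j => ?_
    simp only [gridInterp, fwdDelta, smul_eq_mul]; ring
  have hnext : ∀ t : ℝ, Tendsto (fun j => s j (⌊2 ^ j * t⌋ + 1)) atTop (𝓝 (σ t)) := fun t => by
    have h := (hfloor t).add (hmesh t)
    rw [add_zero] at h
    refine h.congr fun j => ?_
    rw [fwdDelta]; ring
  obtain ⟨g₁, g₂, g₃, h₁, h₂, h₃, hα⟩ := exists_bddHolder_derivs hp hC hoff hdiff hfloor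
  refine ⟨⟨16 * C, fun j hj K => ?_⟩, fun t => ?_, fun α hα₀ hα₁ => ?_⟩
  · obtain ⟨j, rfl⟩ := Nat.exists_eq_add_of_le' hj
    refine (hoff j K).trans (le_of_eq ?_)
    rw [pow_mul, pow_succ]; norm_num; field_simp
  · have hv0 := hv.contDiff.continuous.tendsto (σ t)
    have t1 := tendsto_iff_norm_sub_tendsto_zero.1 (hv0.comp (hfloor t))
    have t2 := tendsto_iff_norm_sub_tendsto_zero.1 (hv0.comp (hnext t))
    have t3 := t1.add t2
    rw [add_zero] at t3
    rw [tendsto_iff_norm_sub_tendsto_zero]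
    exact squeeze_zero (fun _ => norm_nonneg _) (fun j => norm_gridInterp_sub_le j _ t _) t3
  · obtain ⟨H₁, H₂, H₃⟩ := hα α (by exact_mod_cast hα₀) (by exact_mod_cast hα₁)
    exact ⟨isHolderSmooth_three hα₀ h₁ h₂ h₃ H₃,
      isHolderSmooth_comp hB hα₀ hα₁ h₁ h₂ h₃ H₁ H₂ H₃⟩
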